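/- Let $R>0$, let $\theta\in[0,\pi)$ with $\theta\neq\pi/2$, and put $\kappa=\log 2-\gamma-\tan\theta$, where $\gamma$ is Euler's constant. Let $\Delta=-\frac{d^2}{dr^2}-\frac1{4r^2}$ on $[0,R]$, with maximal domain $\mathscr D_{\max}=\{\phi\in L^2([0,R]) : \Delta\phi\in L^2([0,R])\}$, where $\Delta\phi$ is understood in the sense of distributions on $(0,R)$. Every $\phi\in\mathscr D_{\max}$ can be written uniquely as $$\phi=c_1(\phi)\,r^{1/2}+c_2(\phi)\,r^{1/2}\log r+\widetilde\phi,$$ with constants $c_1(\phi),c_2(\phi)\in\mathbb C$ and $\widetilde\phi\in C^1([0,R])$ such that $\widetilde\phi=\mathcal O(r^{3/2})$ and $\widetilde\phi'=\mathcal O(r^{1/2})$ as $r\to0$. Let $\Delta_\theta$ be the restriction of $\Delta$ to the domain $$\mathscr D_\theta=\{\phi\in\mathscr D_{\max} : \cos\theta\,c_1(\phi)+\sin\theta\,c_2(\phi)=0,\ \phi(R)=0\}.$$ For $\mu\in\mathbb C\setminus\{0\}$ define $$F(\mu)=Y_0(\mu R)-\frac2\pi(\log\mu-\kappa)\,J_0(\mu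 R),$$ where $J_0,Y_0$ are the Bessel functions of order zero of the first and second kind and the logarithms (in $F$ and in $Y_0$) are principal. Then for every $\mu\in\mathbb C\setminus\{0\}$, the number $\mu^2$ belongs to the resolvent set of $\Delta_\theta$ if and only if $F(\mu)\neq0$. In that case $F$ is complex differentiable at $\mu$, the resolvent $(\Delta_\theta-\mu^2)^{-1}$ is a trace class operator on $L^2([0,R])$, and $$\operatorname{Tr}(\Delta_\theta-\mu^2)^{-1}=-\frac1{2\mu}\,\frac1{F(\mu)}\,\frac{d}{d\mu}F(\mu)=-\frac1{2\mu}\,\frac{d}{d\mu}\log F(\mu),$$ where $\log F$ is any continuous branch of the logarithm of $F$ near $\mu$; such branches exist and are differentiable at $\mu$. -/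

import Mathlib

open MeasureTheory Set Filter Topology Asymptotics
open scoped ContDiff ComplexConjugate

noncomputable section

/-! ## Bessel functions of order zero -/

/-- The Bessel function of the first kind `J₀`. -/
def besselJZero (z : ℂ) : ℂ :=
  ∑' k : ℕ, (-(z ^ 2) / 4) ^ k / ((k.factorial : ℂ) ^ 2)

/-- The Bessel function of the second kind `Y₀` (principal branch of the logarithm):
`(π/2) Y₀(z) = (log z - log 2 + γ) J₀(z) - ∑_{k ≥ 1} H_k (-z²/4)^k / (k!)²`.
The term `k = 0` of the series below vanishes since `H_0 = 0`. -/
def besselYZero (z : ℂ) : ℂ :=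
  (2 / (Real.pi : ℂ)) *
    ((Complex.log z - (Real.log 2 : ℂ) + (Real.eulerMascheroniConstant : ℂ)) * besselJZero z -
      ∑' k : ℕ, ((harmonic k : ℚ) : ℂ) * (-(z ^ 2) / 4) ^ k / ((k.factorial : ℂ) ^ 2))

/-- `κ = log 2 - γ - tan θ`. -/
def kappaConst (θ : ℝ) : ℝ :=
  Real.log 2 - Real.eulerMascheroniConstant - Real.tan θ

/-- `F(μ) = Y₀(μR) - (2/π) (log μ - κ) J₀(μR)`. -/
def charF (R θ : ℝ) (μ : ℂ) : ℂ :=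
  besselYZero (μ * R) -
    (2 / (Real.pi : ℂ)) * (Complex.log μ - (kappaConst θ : ℂ)) * besselJZero (μ * R)

/-! ## The maximal operator `Δ = -d²/dr² - 1/(4r²)` on `L²([0,R])` -/

/-- The Hilbert space `L²([0,R])` of complex-valued functions. -/
abbrev L2Interval (R : ℝ) : Type := Lp ℂ 2 (volume.restrict (Icc (0 : ℝ) R))

/-- The test functions `C_c^∞((0,R))`. -/
def IsTestFun (R : ℝ) (ξ : ℝ → ℂ) : Prop :=
  ContDiff ℝ ∞ ξ ∧ HasCompactSupport ξ ∧ tsupport ξ ⊆ Ioo 0 R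

/-- The differential expression `Δξ = -ξ'' - ξ/(4r²)` on smooth functions. -/
def deltaExpr (ξ : ℝ → ℂ) (r : ℝ) : ℂ :=
  -(deriv (deriv ξ) r) - ξ r / (4 * (r : ℂ) ^ 2)

/-- `Δφ = f` in the sense of distributions on `(0,R)`. -/
def IsWeakDelta (R : ℝ) (φ f : L2Interval R) : Prop :=
  ∀ ξ : ℝ → ℂ, IsTestFun R ξ →
    ∫ r in Icc (0 : ℝ) R, deltaExpr ξ r * conj (φ r) =
      ∫ r in Icc (0 : ℝ) R, ξ r * conj (f r)

theorem IsTestFun.memLp {R : ℝ} {ξ : ℝ → ℂ} (h : IsTestFun R ξ) :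
    MemLp ξ 2 (volume.restrict (Icc (0 : ℝ) R)) :=
  (h.1.continuous.memLp_of_hasCompactSupport h.2.1).restrict _

theorem IsTestFun.memLp_deltaExpr {R : ℝ} {ξ : ℝ → ℂ} (h : IsTestFun R ξ) :
    MemLp (deltaExpr ξ) 2 (volume.restrict (Icc (0 : ℝ) R)) := by
  obtain ⟨h1, h2, h3⟩ := h
  have hd1 : ContDiff ℝ ∞ (deriv ξ) := (contDiff_infty_iff_deriv.1 h1).2
  have hd2 : ContDiff ℝ ∞ (deriv (deriv ξ)) := (contDiff_infty_iff_deriv.1 hd1).2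
  have hq : Continuous fun r : ℝ => ξ r / (4 * (r : ℂ) ^ 2) := by
    rw [continuous_iff_continuousAt]
    intro r
    by_cases hr : r ∈ tsupport ξ
    · have hr0 : (r : ℂ) ≠ 0 := by exact_mod_cast (h3 hr).1.ne'
      refine h1.continuous.continuousAt.div (by fun_prop) ?_
      exact mul_ne_zero (by norm_num) (pow_ne_zero 2 hr0)
    · have h0 : ξ =ᶠ[𝓝 r] 0 := notMem_tsupport_iff_eventuallyEq.1 hr
      have h0' : (fun r : ℝ => ξ r / (4 * (r : ℂ) ^ 2)) =ᶠ[𝓝 r] fun _ => 0 := by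
        filter_upwards [h0] with x hx
        simp [hx]
      exact continuousAt_const.congr h0'.symm
  have hqs : HasCompactSupport fun r : ℝ => ξ r / (4 * (r : ℂ) ^ 2) := by
    refine h2.mono ?_
    intro r hr
    simp only [Function.mem_support] at hr ⊢
    intro h0
    simp [h0] at hr
  have hs : HasCompactSupport fun r : ℝ => -(deriv (deriv ξ) r) := by
    have := h2.deriv.deriv.comp_left (g := fun z : ℂ => -z) (by simp)
    exact this
  exact ((hd2.continuous.neg.memLp_of_hasCompactSupport hs).sub
    (hq.memLp_of_hasCompactSupport hqs)).restrict _

theorem integrable_mul_conj_of_memLp {R : ℝ} {g : ℝ → ℂ}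
    (hg : MemLp g 2 (volume.restrict (Icc (0 : ℝ) R))) (φ : L2Interval R) :
    Integrable (fun r => g r * conj (φ r)) (volume.restrict (Icc (0 : ℝ) R)) := by
  have h2 : MemLp (fun r => conj (φ r)) 2 (volume.restrict (Icc (0 : ℝ) R)) := (Lp.memLp φ).star
  exact hg.integrable_mul h2

/-- The graph of the maximal operator: all pairs `(φ, f)` in `L² × L²` with `Δφ = f` weakly. -/
def deltaMaxGraph (R : ℝ) : Submodule ℂ (L2Interval R × L2Interval R) where
  carrier := {p | IsWeakDelta R p.1 p.2}
  zero_mem' := by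
    intro ξ hξ
    have h0 : ((0 : L2Interval R) : ℝ → ℂ) =ᵐ[volume.restrict (Icc (0 : ℝ) R)] 0 :=
      Lp.coeFn_zero _ _ _
    have e1 : ∀ g : ℝ → ℂ,
        ∫ r in Icc (0 : ℝ) R, g r * conj ((0 : L2Interval R) r) = 0 := by
      intro g
      refine integral_eq_zero_of_ae ?_
      filter_upwards [h0] with r hr
      simp only [hr, Pi.zero_apply, map_zero, mul_zero]
    exact (e1 _).trans (e1 _).symm
  add_mem' := by
    intro p q hp hq ξ hξ
    have key : ∀ (g : ℝ → ℂ), MemLp g 2 (volume.restrict (Icc (0 : ℝ) R)) →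
        ∀ u v : L2Interval R, ∫ r in Icc (0 : ℝ) R, g r * conj ((u + v) r) =
          (∫ r in Icc (0 : ℝ) R, g r * conj (u r)) +
            ∫ r in Icc (0 : ℝ) R, g r * conj (v r) := by
      intro g hg u v
      rw [← integral_add (integrable_mul_conj_of_memLp hg u)
        (integrable_mul_conj_of_memLp hg v)]
      refine integral_congr_ae ?_
      filter_upwards [Lp.coeFn_add u v] with r hr
      rw [hr, Pi.add_apply, map_add, mul_add]
    have hp' := hp ξ hξ
    have hq' := hq ξ hξ
    simp only [Prod.fst_add, Prod.snd_add]
    rw [key _ hξ.memLp_deltaExpr, key _ hξ.memLp, hp', hq']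
  smul_mem' := by
    intro c p hp ξ hξ
    have key : ∀ (g : ℝ → ℂ) (u : L2Interval R),
        ∫ r in Icc (0 : ℝ) R, g r * conj ((c • u) r) =
          conj c * ∫ r in Icc (0 : ℝ) R, g r * conj (u r) := by
      intro g u
      rw [← integral_const_mul]
      refine integral_congr_ae ?_
      filter_upwards [Lp.coeFn_smul c u] with r hr
      rw [hr, Pi.smul_apply, smul_eq_mul, map_mul]
      ring
    have hp' := hp ξ hξ
    simp only [Prod.smul_fst, Prod.smul_snd]
    rw [key, key, hp']

/-- The distribution `Δφ` determines its representative in `L²`: the graph is single-valued. -/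
theorem deltaMaxGraph_single_valued (R : ℝ) (x : L2Interval R × L2Interval R)
    (hx : x ∈ deltaMaxGraph R) (hx0 : x.1 = 0) : x.2 = 0 := by
  obtain ⟨φ, f⟩ := x
  simp only at hx0 ⊢
  subst hx0
  have hz : IsWeakDelta R 0 f := hx
  have hint : ∀ g : ℝ → ℝ, ContDiff ℝ ∞ g → HasCompactSupport g → tsupport g ⊆ Ioo 0 R →
      ∫ r, g r • conj (f r) ∂(volume.restrict (Icc (0 : ℝ) R)) = 0 := by
    intro g hg1 hg2 hg3
    have hT : IsTestFun R fun r => (g r : ℂ) := by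
      refine ⟨Complex.ofRealCLM.contDiff.comp hg1, ?_, ?_⟩
      · exact hg2.comp_left (g := fun x : ℝ => (x : ℂ)) (by simp)
      · exact (tsupport_comp_subset (g := fun x : ℝ => (x : ℂ)) (by simp) g).trans hg3
    have h1 := hz _ hT
    have h0 : ((0 : L2Interval R) : ℝ → ℂ) =ᵐ[volume.restrict (Icc (0 : ℝ) R)] 0 :=
      Lp.coeFn_zero _ _ _
    have h2 : ∫ r in Icc (0 : ℝ) R, deltaExpr (fun r => (g r : ℂ)) r *
        conj ((0 : L2Interval R) r) = 0 := by
      refine integral_eq_zero_of_ae ?_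
      filter_upwards [h0] with r hr
      simp only [hr, Pi.zero_apply, map_zero, mul_zero]
    rw [h2] at h1
    simpa only [Complex.real_smul] using h1.symm
  have hfi : Integrable (fun r => conj (f r)) (volume.restrict (Icc (0 : ℝ) R)) :=
    ((Lp.memLp f).star).integrable (by norm_num)
  have hae := isOpen_Ioo.ae_eq_zero_of_integral_contDiff_smul_eq_zero
    (U := Ioo (0 : ℝ) R) (hfi.locallyIntegrable.locallyIntegrableOn _) hint
  refine (Lp.eq_zero_iff_ae_eq_zero).2 ?_
  have hmem : ∀ᵐ r ∂(volume.restrict (Icc (0 : ℝ) R)), r ∈ Ioo (0 : ℝ) R := by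
    rw [← restrict_Ioo_eq_restrict_Icc]
    exact ae_restrict_mem measurableSet_Ioo
  filter_upwards [hae, hmem] with r hr hr'
  simpa using hr hr'

/-- The maximal operator `Δ : D_max(Δ) → L²([0,R])`,
with `D_max(Δ) = {φ ∈ L² | Δφ ∈ L²}` in the distributional sense. -/
def deltaMax (R : ℝ) : L2Interval R →ₗ.[ℂ] L2Interval R :=
  (deltaMaxGraph R).toLinearPMap

theorem deltaMax_graph (R : ℝ) : (deltaMax R).graph = deltaMaxGraph R :=
  Submodule.toLinearPMap_graph_eq _ (deltaMaxGraph_single_valued R)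

/-! ## Boundary data and the realization `Δ_θ` -/

/-- `φ = c₁ r^{1/2} + c₂ r^{1/2} log r + φ̃` on `[0,R]`, with `φ̃` continuously differentiable on
`[0,R]`, `φ̃ = O(r^{3/2})` and `φ̃' = O(r^{1/2})` as `r → 0`; `b` is the boundary value `φ(R)`.
For `φ` in the maximal domain, `Δφ̃ = Δφ` is automatically in `L²`, because `r^{1/2}` and
`r^{1/2} log r` are annihilated by `Δ`. -/
def HasBoundaryData (R : ℝ) (φ : L2Interval R) (c₁ c₂ b : ℂ) : Prop :=
  ∃ ψ : ℝ → ℂ,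
    ContDiffOn ℝ 1 ψ (Icc 0 R) ∧
    (ψ =O[𝓝[>] (0 : ℝ)] fun r : ℝ => r ^ (3 / 2 : ℝ)) ∧
    (derivWithin ψ (Icc 0 R) =O[𝓝[>] (0 : ℝ)] fun r : ℝ => r ^ (1 / 2 : ℝ)) ∧
    (∀ᵐ r ∂(volume.restrict (Icc (0 : ℝ) R)),
      φ r = c₁ * (√r : ℝ) + c₂ * (√r * Real.log r : ℝ) + ψ r) ∧
    b = c₁ * (√R : ℝ) + c₂ * (√R * Real.log R : ℝ) + ψ R

theorem HasBoundaryData.zero (R : ℝ) : HasBoundaryData R 0 0 0 0 := by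
  refine ⟨fun _ => 0, contDiffOn_const, isBigO_zero _ _, ?_, ?_, by simp⟩
  · have : derivWithin (fun _ : ℝ => (0 : ℂ)) (Icc 0 R) = fun _ => 0 := by
      funext r
      simp
    rw [this]
    exact isBigO_zero _ _
  · filter_upwards [Lp.coeFn_zero ℂ 2 (volume.restrict (Icc (0 : ℝ) R))] with r hr
    rw [hr]
    simp

theorem HasBoundaryData.add {R : ℝ} (hR : 0 < R) {φ φ' : L2Interval R}
    {c₁ c₂ b c₁' c₂' b' : ℂ} (h : HasBoundaryData R φ c₁ c₂ b)
    (h' : HasBoundaryData R φ' c₁' c₂' b') :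
    HasBoundaryData R (φ + φ') (c₁ + c₁') (c₂ + c₂') (b + b') := by
  obtain ⟨ψ, h1, h2, h3, h4, h5⟩ := h
  obtain ⟨ψ', h1', h2', h3', h4', h5'⟩ := h'
  refine ⟨fun r => ψ r + ψ' r, h1.add h1', h2.add h2', ?_, ?_, ?_⟩
  · refine (h3.add h3').congr' ?_ EventuallyEq.rfl
    filter_upwards [Ioo_mem_nhdsGT hR] with r hr
    have hr' : r ∈ Icc 0 R := ⟨hr.1.le, hr.2.le⟩
    exact (derivWithin_fun_add (h1.differentiableOn (by norm_num) r hr')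
      (h1'.differentiableOn (by norm_num) r hr')).symm
  · filter_upwards [h4, h4', Lp.coeFn_add φ φ'] with r hr hr' hs
    rw [hs, Pi.add_apply, hr, hr']
    ring
  · rw [h5, h5']
    ring

theorem HasBoundaryData.smul {R : ℝ} (c : ℂ) {φ : L2Interval R}
    {c₁ c₂ b : ℂ} (h : HasBoundaryData R φ c₁ c₂ b) :
    HasBoundaryData R (c • φ) (c * c₁) (c * c₂) (c * b) := by
  obtain ⟨ψ, h1, h2, h3, h4, h5⟩ := h
  refine ⟨fun r => c * ψ r, contDiffOn_const.mul h1, h2.const_mul_left c, ?_, ?_, ?_⟩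
  · have : derivWithin (fun r => c * ψ r) (Icc 0 R) =
        fun r => c * derivWithin ψ (Icc 0 R) r := by
      funext r
      exact derivWithin_const_mul_field c
    rw [this]
    exact h3.const_mul_left c
  · filter_upwards [h4, Lp.coeFn_smul c φ] with r hr hs
    rw [hs, Pi.smul_apply, hr, smul_eq_mul]
    ring
  · rw [h5]
    ring

/-- The boundary conditions `cos θ c₁(φ) + sin θ c₂(φ) = 0` and `φ(R) = 0`. -/
def boundarySpace (R : ℝ) (hR : 0 < R) (θ : ℝ) : Submodule ℂ (L2Interval R) where
  carrier := {φ | ∃ c₁ c₂ : ℂ, HasBoundaryData R φ c₁ c₂ 0 ∧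
    (Real.cos θ : ℂ) * c₁ + (Real.sin θ : ℂ) * c₂ = 0}
  zero_mem' := ⟨0, 0, HasBoundaryData.zero R, by simp⟩
  add_mem' := by
    rintro φ φ' ⟨c₁, c₂, h, hc⟩ ⟨c₁', c₂', h', hc'⟩
    refine ⟨c₁ + c₁', c₂ + c₂', by simpa using h.add hR h', ?_⟩
    linear_combination hc + hc'
  smul_mem' := by
    rintro c φ ⟨c₁, c₂, h, hc⟩
    refine ⟨c * c₁, c * c₂, by simpa using h.smul c, ?_⟩
    linear_combination c * hc

/-- The realization `Δ_θ`: the restriction of the maximal operator to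
`D_θ = {φ ∈ D_max(Δ) | cos θ c₁(φ) + sin θ c₂(φ) = 0, φ(R) = 0}`. -/
def deltaTheta (R : ℝ) (hR : 0 < R) (θ : ℝ) : L2Interval R →ₗ.[ℂ] L2Interval R :=
  (deltaMax R).domRestrict (boundarySpace R hR θ)

/-! ## Resolvents and traces -/

section Hilbert

variable {H : Type} [NormedAddCommGroup H] [InnerProductSpace ℂ H]

/-- The bounded operator `S` is the resolvent `(A - z)⁻¹` of the unbounded operator `A`. -/
def IsResolventAt (A : H →ₗ.[ℂ] H) (z : ℂ) (S : H →L[ℂ] H) : Prop :=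
  (∀ x : A.domain, S (A x - z • (x : H)) = x) ∧
    ∀ y : H, ∃ x : A.domain, (x : H) = S y ∧ A x - z • (x : H) = y

/-- The resolvent set of the unbounded operator `A`. -/
def unboundedResolventSet (A : H →ₗ.[ℂ] H) : Set ℂ :=
  {z | ∃ S : H →L[ℂ] H, IsResolventAt A z S}

/-- Trace class (nuclear) operators on a Hilbert space:
`T = ∑ₙ ⟨xₙ, ·⟩ yₙ` with `∑ₙ ‖xₙ‖ ‖yₙ‖ < ∞`. -/
def IsTraceClass (T : H →L[ℂ] H) : Prop :=
  ∃ x y : ℕ → H, Summable (fun n => ‖x n‖ * ‖y n‖) ∧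
    ∀ v : H, HasSum (fun n => inner ℂ (x n) v • y n) (T v)

/-- `T` is trace class and `Tr T = t`: `∑ᵢ ⟨eᵢ, T eᵢ⟩ = t` for every orthonormal basis. -/
def HasTrace (T : H →L[ℂ] H) (t : ℂ) : Prop :=
  IsTraceClass T ∧ ∀ (ι : Type) (e : HilbertBasis ι ℂ H),
    HasSum (fun i => inner ℂ (e i) (T (e i))) t

end Hilbert

end

/-! Write `V` for `zeroEnergyOp`, the right inverse of Δ whose values have c₁ = c₂ = 0. It comes
from reducing Δφ = g to two integrations: (Vg)(r) = -√r ∫₀ʳ s⁻¹ ∫₀ˢ √t g(t) dt ds. It is a Volterra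
operator, its powers decay factorially, and N(z) = (1 - zV)⁻¹ (`neumann`) is given by its Neumann
series for every z.

Let u₀ = √r (log r - tan θ). It satisfies Δu₀ = 0 and the boundary condition at 0, and φ_z = N(z)u₀
solves Δφ = zφ with the same c₁, c₂. Let B(z) = `bdryValue` be the value of φ_z at R. The functions
Vⁿu₀ are explicit (`zeroEnergyOp_pow_logModeLp`); summing them at r = R yields the Bessel series,
and the logarithms of μ cancel: F(μ) = (2/π) R^{-1/2} B(μ²) (`charF_eq`).

If B(z) = 0, then φ_z is an eigenfunction. If B(z) ≠ 0, subtracting a multiple of φ_z from VN(z)y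
corrects the value at R, so with b the functional g ↦ (Vg)(R) the resolvent is VN(z) - B(z)⁻¹
b(N(z)·) φ_z (`isResolventAt_thetaResolvent`). Injectivity rests on two facts: weak L² solutions of
Δh = 0 are spanned by √r and √r log r (`exists_eq_of_isWeakDelta_zero`), and boundary data are
unique (`HasBoundaryData.unique`).

For the trace, V is a product of two Hilbert–Schmidt Volterra operators, so VN(z) is trace class and
the integral over its diagonal is 0 (`hasTrace_zeroEnergyOp_comp_neumann`). The rank one term
contributes -B(z)⁻¹ b(N(z)φ_z), and b(N(z)φ_z) = B′(z) (`hasDerivAt_bdryValue`). Hence the trace is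
-B′/B at z = μ², which the chain rule turns into -F′/(2μF). -/

/-! ### Nuclear operators and basis independence of the trace. -/

section TraceClass

variable {H : Type} [NormedAddCommGroup H] [InnerProductSpace ℂ H]

/-- Any countable family is transported to ℕ along an injection and extended by zero. This frees
later arguments to index by a sum type or by a Hilbert basis, finite or not. -/
theorem isTraceClass_of_countable {ι : Type*} [Countable ι] {T : H →L[ℂ] H} (x y : ι → H)
    (hs : Summable fun i => ‖x i‖ * ‖y i‖)
    (hT : ∀ v : H, HasSum (fun i => inner ℂ (x i) v • y i) (T v)) : IsTraceClass T := by
  obtain ⟨f, hf⟩ := exists_injective_nat ι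
  -- General in `g` so that it serves both the products of norms and the rank one terms.
  have key : ∀ {E : Type _} [AddCommMonoid E] (g : H → H → E), g 0 0 = 0 →
      (fun n => g (Function.extend f x 0 n) (Function.extend f y 0 n)) =
        Function.extend f (fun i => g (x i) (y i)) 0 := by
    intro E _ g hg
    funext n
    by_cases hn : ∃ i, f i = n
    · obtain ⟨i, rfl⟩ := hn
      simp only [hf.extend_apply]
    · simp only [Function.extend_apply' _ _ _ hn, Pi.zero_apply, hg]
  refine ⟨Function.extend f x 0, Function.extend f y 0, ?_, fun v => ?_⟩
  · rw [key (fun a b => ‖a‖ * ‖b‖) (by simp)]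
    exact (hasSum_extend_zero hf).2 hs.hasSum |>.summable
  · rw [key (fun a b => inner ℂ a v • b) (by simp)]
    exact (hasSum_extend_zero hf).2 (hT v)

theorem IsTraceClass.add {S T : H →L[ℂ] H} (hS : IsTraceClass S) (hT : IsTraceClass T) :
    IsTraceClass (S + T) := by
  obtain ⟨x, y, h1, h2⟩ := hS
  obtain ⟨x', y', h1', h2'⟩ := hT
  refine isTraceClass_of_countable (ι := ℕ ⊕ ℕ) (Sum.elim x x') (Sum.elim y y') ?_ fun v => ?_
  · exact (HasSum.sum (by simpa [Function.comp_def] using h1.hasSum)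
      (by simpa [Function.comp_def] using h1'.hasSum)).summable
  · exact HasSum.sum (by simpa [Function.comp_def] using h2 v)
      (by simpa [Function.comp_def] using h2' v)

theorem HasTrace.add {S T : H →L[ℂ] H} {s t : ℂ} (hS : HasTrace S s) (hT : HasTrace T t) :
    HasTrace (S + T) (s + t) := by
  refine ⟨hS.1.add hT.1, fun ι e => ?_⟩
  simpa [inner_add_right] using (hS.2 ι e).add (hT.2 ι e)

/-- Cauchy–Schwarz followed by Bessel's inequality in each factor. It supplies the absolute
summability needed to interchange sums, and later the dominating constant for integrals. -/
theorem sum_norm_inner_mul_norm_inner_le {ι : Type*} {e : ι → H} (he : Orthonormal ℂ e)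
    (x y : H) (s : Finset ι) :
    ∑ i ∈ s, ‖inner ℂ x (e i)‖ * ‖inner ℂ (e i) y‖ ≤ ‖x‖ * ‖y‖ := by
  have h1 : ∑ i ∈ s, ‖inner ℂ x (e i)‖ ^ 2 ≤ ‖x‖ ^ 2 := by
    simpa only [norm_inner_symm x] using he.sum_inner_products_le x (s := s)
  have h2 : ∑ i ∈ s, ‖inner ℂ (e i) y‖ ^ 2 ≤ ‖y‖ ^ 2 := he.sum_inner_products_le y
  refine (Real.sum_mul_le_sqrt_mul_sqrt s _ _).trans ?_
  exact mul_le_mul ((Real.sqrt_le_left (norm_nonneg _)).2 h1)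
    ((Real.sqrt_le_left (norm_nonneg _)).2 h2) (Real.sqrt_nonneg _) (norm_nonneg _)

/-- The sum `∑ₙ ⟨xₙ, yₙ⟩` of a nuclear representation is the trace, in every Hilbert basis. -/
theorem hasTrace_of_nuclear {T : H →L[ℂ] H} (x y : ℕ → H)
    (hs : Summable fun n => ‖x n‖ * ‖y n‖)
    (hT : ∀ v : H, HasSum (fun n => inner ℂ (x n) v • y n) (T v)) :
    HasTrace T (∑' n, inner ℂ (x n) (y n)) := by
  refine ⟨⟨x, y, hs, hT⟩, fun ι e => ?_⟩
  -- Summing this array over the basis first gives ⟨xₙ, yₙ⟩ by Parseval; summing over n first gives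
  -- ⟨eᵢ, T eᵢ⟩. Absolute summability makes the two totals agree.
  set g : ℕ × ι → ℂ := fun p => inner ℂ (x p.1) (e p.2) * inner ℂ (e p.2) (y p.1) with hg
  have hrow : ∀ n, Summable fun i => ‖g (n, i)‖ := fun n =>
    summable_of_sum_le (fun _ => norm_nonneg _) fun s => by
      simpa [hg] using sum_norm_inner_mul_norm_inner_le e.orthonormal (x n) (y n) s
  have hsum : Summable g := by
    refine Summable.of_norm ?_
    refine (summable_prod_of_nonneg fun _ => norm_nonneg _).2 ⟨hrow, ?_⟩
    refine Summable.of_nonneg_of_le (fun n => tsum_nonneg fun _ => norm_nonneg _)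
      (fun n => ?_) hs
    refine Real.tsum_le_of_sum_le (fun _ => norm_nonneg _) fun s => ?_
    simpa [hg] using sum_norm_inner_mul_norm_inner_le e.orthonormal (x n) (y n) s
  have h1 : HasSum (fun n => inner ℂ (x n) (y n)) (∑' p, g p) :=
    hsum.hasSum.prod_fiberwise fun n => e.hasSum_inner_mul_inner (x n) (y n)
  have h2 : HasSum (fun i => inner ℂ (e i) (T (e i))) (∑' p, g p) := by
    have h3 : HasSum (g ∘ Prod.swap) (∑' p, g p) :=
      (Equiv.prodComm ι ℕ).hasSum_iff.2 hsum.hasSum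
    refine h3.prod_fiberwise fun i => ?_
    have := (hT (e i)).mapL (innerSL ℂ (e i))
    simpa [hg, inner_smul_right] using this
  rw [h1.tsum_eq]
  exact h2

/-- Once nuclearity is known the trace does not depend on the basis, so a computation in a single
convenient basis suffices. -/
theorem IsTraceClass.hasTrace_of_hasSum {T : H →L[ℂ] H} (hT : IsTraceClass T) {ι : Type}
    (e : HilbertBasis ι ℂ H) {t : ℂ} (ht : HasSum (fun i => inner ℂ (e i) (T (e i))) t) :
    HasTrace T t := by
  obtain ⟨x, y, hs, h⟩ := hT
  have := hasTrace_of_nuclear x y hs h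
  rwa [(this.2 ι e).unique ht] at this

theorem hasTrace_rankOne (x y : H) (T : H →L[ℂ] H) (hT : ∀ v, T v = inner ℂ x v • y) :
    HasTrace T (inner ℂ x y) := by
  have h1 : ∀ (E : Type _) [NormedAddCommGroup E] (g : H → H → E), g 0 0 = 0 →
      HasSum (fun n : ℕ => g (if n = 0 then x else 0) (if n = 0 then y else 0)) (g x y) := by
    intro E _ g hg
    have := hasSum_ite_eq (α := E) (0 : ℕ) (g x y)
    refine this.congr_fun ?_
    intro n
    split_ifs <;> simp [hg]
  have h2 := hasTrace_of_nuclear (T := T) (fun n : ℕ => if n = 0 then x else 0)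
    (fun n : ℕ => if n = 0 then y else 0) (h1 ℝ (fun a b => ‖a‖ * ‖b‖) (by simp)).summable
    (fun v => by rw [hT]; exact h1 H (fun a b => inner ℂ a v • b) (by simp))
  rwa [(h1 ℂ (fun a b => inner ℂ a b) (by simp)).tsum_eq] at h2

end TraceClass

/-! ### Carleman operators, Hilbert–Schmidt sums and diagonal integrals. -/

section Carleman

variable {X : Type} [MeasurableSpace X] {ν : Measure X} [IsFiniteMeasure ν]
  {H : Type} [NormedAddCommGroup H] [InnerProductSpace ℂ H]

omit [IsFiniteMeasure ν] in
theorem norm_sq_eq_integral (f : Lp ℂ 2 ν) : ‖f‖ ^ 2 = ∫ x, ‖f x‖ ^ 2 ∂ν := by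
  have h : (‖f‖ ^ 2 : ℂ) = ((∫ x, ‖f x‖ ^ 2 ∂ν : ℝ) : ℂ) := by
    have := inner_self_eq_norm_sq_to_K (𝕜 := ℂ) f
    rw [L2.inner_def] at this
    rw [← integral_complex_ofReal]
    simp only [inner_self_eq_norm_sq_to_K] at this
    simpa using this.symm
  exact_mod_cast h

/-- A bounded Carleman operator: `(T f)(x) = ⟨k x, f⟩` for almost every `x`, with `k` bounded. -/
def IsCarleman (T : H →L[ℂ] Lp ℂ 2 ν) (k : X → H) (C : ℝ) : Prop :=
  (∀ x, ‖k x‖ ≤ C) ∧ ∀ f : H, T f =ᵐ[ν] fun x => inner ℂ (k x) f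

omit [IsFiniteMeasure ν] in
theorem IsCarleman.comp [CompleteSpace H] {T : H →L[ℂ] Lp ℂ 2 ν} {k : X → H} {C : ℝ}
    (h : IsCarleman T k C)
    (D : H →L[ℂ] H) : IsCarleman (T ∘L D) (fun x => D.adjoint (k x)) (‖D‖ * C) := by
  refine ⟨fun x => ?_, fun f => ?_⟩
  · refine (D.adjoint.le_opNorm _).trans ?_
    rw [LinearIsometryEquiv.norm_map]
    exact mul_le_mul_of_nonneg_left (h.1 x) (norm_nonneg _)
  · filter_upwards [h.2 (D f)] with x hx
    simpa [ContinuousLinearMap.adjoint_inner_left] using hx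

/-- Bessel's inequality at almost every x bounds Σ|⟨k x, eᵢ⟩|² by C², and the measure is finite:
bounded sections make the operator Hilbert–Schmidt. -/
theorem IsCarleman.summable_norm_sq {T : H →L[ℂ] Lp ℂ 2 ν} {k : X → H} {C : ℝ}
    (h : IsCarleman T k C) {ι : Type} {e : ι → H} (he : Orthonormal ℂ e) :
    Summable fun i => ‖T (e i)‖ ^ 2 := by
  refine summable_of_sum_le (c := ∫ _, C ^ 2 ∂ν) (fun _ => sq_nonneg _) fun s => ?_
  have hint : ∀ i, Integrable (fun x => ‖T (e i) x‖ ^ 2) ν := fun i =>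
    (Lp.memLp (T (e i))).integrable_norm_pow (by norm_num)
  simp only [norm_sq_eq_integral]
  rw [← integral_finsetSum _ fun i _ => hint i]
  refine integral_mono_ae (integrable_finsetSum _ fun i _ => hint i) (integrable_const _) ?_
  have hall : ∀ᵐ x ∂ν, ∀ i ∈ s, T (e i) x = inner ℂ (k x) (e i) :=
    (ae_ball_iff s.countable_toSet).2 fun i _ => h.2 (e i)
  filter_upwards [hall] with x hx
  calc ∑ i ∈ s, ‖T (e i) x‖ ^ 2 = ∑ i ∈ s, ‖inner ℂ (e i) (k x)‖ ^ 2 :=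
        Finset.sum_congr rfl fun i hi => by rw [hx i hi, norm_inner_symm]
    _ ≤ ‖k x‖ ^ 2 := he.sum_inner_products_le _
    _ ≤ C ^ 2 := pow_le_pow_left₀ (norm_nonneg _) (h.1 x) 2

/-- Parseval pointwise in x, then dominated convergence with the constant bound C′C. Countability of
the basis allows a single null set to serve all basis vectors. -/
theorem IsCarleman.hasSum_inner {S T : H →L[ℂ] Lp ℂ 2 ν} {k l : X → H} {C C' : ℝ}
    (hS : IsCarleman S k C) (hT : IsCarleman T l C') {ι : Type} [Countable ι]
    (e : HilbertBasis ι ℂ H) :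
    HasSum (fun i => inner ℂ (S (e i)) (T (e i))) (∫ x, inner ℂ (l x) (k x) ∂ν) := by
  have hall : ∀ᵐ x ∂ν, ∀ i, S (e i) x = inner ℂ (k x) (e i) ∧ T (e i) x = inner ℂ (l x) (e i) :=
    ae_all_iff.2 fun i => (hS.2 (e i)).and (hT.2 (e i))
  have hint : ∀ i, Integrable (fun x => inner ℂ (S (e i) x) (T (e i) x)) ν := fun i =>
    L2.integrable_inner (S (e i)) (T (e i))
  have hterm : ∀ᵐ x ∂ν, ∀ i, inner ℂ (S (e i) x) (T (e i) x) =
      inner ℂ (l x) (e i) * inner ℂ (e i) (k x) := by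
    filter_upwards [hall] with x hx i
    rw [(hx i).1, (hx i).2, RCLike.inner_apply, inner_conj_symm]
  have hlim : ∀ᵐ x ∂ν, Tendsto (fun s : Finset ι => ∑ i ∈ s, inner ℂ (S (e i) x) (T (e i) x))
      atTop (𝓝 (inner ℂ (l x) (k x))) := by
    filter_upwards [hterm] with x hx
    simp only [hx]
    exact e.hasSum_inner_mul_inner (l x) (k x)
  have := tendsto_integral_filter_of_dominated_convergence (fun _ => C' * C)
    (Eventually.of_forall fun s : Finset ι =>
      (integrable_finsetSum s fun i _ => hint i).aestronglyMeasurable)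
    (Eventually.of_forall fun s => ?_) (integrable_const _) hlim
  · refine this.congr fun s => ?_
    rw [integral_finsetSum _ fun i _ => hint i]
    rfl
  · filter_upwards [hterm] with x hx
    simp only [hx]
    refine (norm_sum_le _ _).trans ?_
    simp only [norm_mul]
    refine (sum_norm_inner_mul_norm_inner_le e.orthonormal _ _ s).trans ?_
    exact mul_le_mul (hT.1 x) (hS.1 x) (norm_nonneg _) ((norm_nonneg _).trans (hT.1 x))

/-- Distinct basis vectors are √2 apart, so balls of radius 1/2 around them are disjoint open sets,
and a separable space has only countably many of those. -/
theorem exists_countable_hilbertBasis [CompleteSpace H] [SecondCountableTopology H] :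
    ∃ (ι : Type) (_ : Countable ι), Nonempty (HilbertBasis ι ℂ H) := by
  obtain ⟨w, b, hb⟩ := exists_hilbertBasis ℂ H
  have hd : Pairwise fun i j : w => Disjoint (Metric.ball (b i) (1 / 2)) (Metric.ball (b j) (1 / 2)) := by
    intro i j hij
    refine Metric.ball_disjoint_ball ?_
    have h1 : ‖b i - b j‖ ^ 2 = 2 := by
      have := norm_sub_sq (𝕜 := ℂ) (b i) (b j)
      rw [b.orthonormal.2 hij, b.orthonormal.1, b.orthonormal.1] at this
      norm_num at this
      exact this
    rw [dist_eq_norm]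
    nlinarith [norm_nonneg (b i - b j)]
  have : w.Countable := by
    have := Set.PairwiseDisjoint.countable_of_isOpen (ι := w) (a := Set.univ)
      (s := fun i => Metric.ball (b i) (1 / 2)) (fun i _ j _ hij => hd hij)
      (fun _ _ => Metric.isOpen_ball) (fun i _ => ⟨b i, Metric.mem_ball_self (by norm_num)⟩)
    exact Set.countable_univ_iff.1 this
  exact ⟨w, this, ⟨b⟩⟩

/-- A product of two Hilbert–Schmidt operators with a bounded operator is trace class, and its
trace is the integral over the diagonal. -/
theorem hasTrace_comp_comp [SecondCountableTopology (Lp ℂ 2 ν)]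
    {A B : Lp ℂ 2 ν →L[ℂ] Lp ℂ 2 ν} {a a' b b' : X → Lp ℂ 2 ν} {Ca Ca' Cb Cb' : ℝ}
    (hA : IsCarleman A a Ca) (hA' : IsCarleman A.adjoint a' Ca')
    (hB : IsCarleman B b Cb) (hB' : IsCarleman B.adjoint b' Cb') (D : Lp ℂ 2 ν →L[ℂ] Lp ℂ 2 ν) :
    HasTrace (A ∘L B ∘L D) (∫ x, inner ℂ (b x) (D (a' x)) ∂ν) := by
  obtain ⟨ι, _, ⟨e⟩⟩ := exists_countable_hilbertBasis (H := Lp ℂ 2 ν)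
  have htc : IsTraceClass (A ∘L B ∘L D) := by
    -- Expanding BDv in the basis gives ABDv = Σ ⟨D*B*eᵢ, v⟩ A eᵢ. Both families are square
    -- summable, so the products of norms are summable.
    refine isTraceClass_of_countable (fun i => D.adjoint (B.adjoint (e i))) (fun i => A (e i))
      ?_ fun v => ?_
    · have h1 := (hB'.summable_norm_sq e.orthonormal).mul_left (‖D‖ ^ 2)
      have h2 := hA.summable_norm_sq e.orthonormal
      refine Summable.of_nonneg_of_le (fun _ => by positivity) (fun i => ?_) (h1.add h2)
      have h3 : ‖D.adjoint (B.adjoint (e i))‖ ≤ ‖D‖ * ‖B.adjoint (e i)‖ := by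
        refine (D.adjoint.le_opNorm _).trans_eq ?_
        rw [LinearIsometryEquiv.norm_map]
      nlinarith [norm_nonneg (A (e i)), norm_nonneg (D.adjoint (B.adjoint (e i))),
        sq_nonneg (‖D‖ * ‖B.adjoint (e i)‖ - ‖A (e i)‖), sq_nonneg (‖D‖ * ‖B.adjoint (e i)‖),
        mul_le_mul_of_nonneg_right h3 (norm_nonneg (A (e i)))]
    · have := (e.hasSum_repr (B (D v))).mapL A
      simpa [ContinuousLinearMap.adjoint_inner_left, e.repr_apply_apply] using this
  refine htc.hasTrace_of_hasSum e ?_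
  -- The trace is read as Σ ⟨A*eᵢ, BD eᵢ⟩, a Hilbert–Schmidt pairing of two Carleman operators.
  have := hA'.hasSum_inner (hB.comp D) e
  simpa [ContinuousLinearMap.adjoint_inner_left] using this

end Carleman

/-! ### Integral operators with bounded sections and their adjoints. -/

section Kernel

variable {X : Type} [MeasurableSpace X] {ν : Measure X} [IsFiniteMeasure ν]

/-- Measurable real kernels whose sections have uniformly bounded `L²` norm. -/
structure IsBddKernel (ν : Measure X) (k : X → X → ℝ) (C : ℝ) : Prop where
  measurable : Measurable (Function.uncurry k)
  nonneg : 0 ≤ C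
  memLp : ∀ x, MemLp (fun y => (k x y : ℂ)) 2 ν
  norm_le : ∀ x, ‖(memLp x).toLp‖ ≤ C

variable {k : X → X → ℝ} {C : ℝ}

omit [IsFiniteMeasure ν] in
theorem IsBddKernel.inner_eq (hk : IsBddKernel ν k C) (x : X) (f : Lp ℂ 2 ν) :
    inner ℂ (hk.memLp x).toLp f = ∫ y, (k x y : ℂ) * f y ∂ν := by
  rw [L2.inner_def]
  refine integral_congr_ae ?_
  filter_upwards [(hk.memLp x).coeFn_toLp] with y hy
  rw [hy, RCLike.inner_apply]
  simp [mul_comm]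

omit [IsFiniteMeasure ν] in
theorem IsBddKernel.norm_integral_le (hk : IsBddKernel ν k C) (f : Lp ℂ 2 ν) (x : X) :
    ‖∫ y, (k x y : ℂ) * f y ∂ν‖ ≤ C * ‖f‖ := by
  rw [← hk.inner_eq]
  exact (norm_inner_le_norm _ _).trans
    (mul_le_mul_of_nonneg_right (hk.norm_le x) (norm_nonneg _))

theorem IsBddKernel.aestronglyMeasurable (hk : IsBddKernel ν k C) (f : Lp ℂ 2 ν) :
    AEStronglyMeasurable (fun x => ∫ y, (k x y : ℂ) * f y ∂ν) ν := by
  refine StronglyMeasurable.aestronglyMeasurable ?_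
  refine StronglyMeasurable.integral_prod_right
    (f := fun x y => (k x y : ℂ) * f y) ?_
  exact (Complex.measurable_ofReal.comp hk.measurable).stronglyMeasurable.mul
    ((Lp.stronglyMeasurable f).comp_measurable measurable_snd)

theorem IsBddKernel.memLp_integral (hk : IsBddKernel ν k C) (f : Lp ℂ 2 ν) :
    MemLp (fun x => ∫ y, (k x y : ℂ) * f y ∂ν) 2 ν :=
  MemLp.of_bound (hk.aestronglyMeasurable f) (C * ‖f‖)
    (Eventually.of_forall (hk.norm_integral_le f))

omit [IsFiniteMeasure ν] in
theorem IsBddKernel.integrable_mul (hk : IsBddKernel ν k C) (f : Lp ℂ 2 ν) (x : X) :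
    Integrable (fun y => (k x y : ℂ) * f y) ν :=
  (hk.memLp x).integrable_mul (Lp.memLp f)

/-- The integral operator with kernel `k`. -/
noncomputable def kernelOp (hk : IsBddKernel ν k C) : Lp ℂ 2 ν →L[ℂ] Lp ℂ 2 ν :=
  LinearMap.mkContinuous
    { toFun := fun f => (hk.memLp_integral f).toLp
      map_add' := by
        intro f g
        rw [← MemLp.toLp_add]
        refine MemLp.toLp_congr _ _ (Eventually.of_forall fun x => ?_)
        simp only [Pi.add_apply]
        rw [← integral_add (hk.integrable_mul f x) (hk.integrable_mul g x)]
        refine integral_congr_ae ?_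
        filter_upwards [Lp.coeFn_add f g] with y hy
        rw [hy, Pi.add_apply, mul_add]
      map_smul' := by
        intro c f
        rw [RingHom.id_apply, ← MemLp.toLp_const_smul]
        refine MemLp.toLp_congr _ _ (Eventually.of_forall fun x => ?_)
        simp only [Pi.smul_apply]
        rw [← integral_smul]
        refine integral_congr_ae ?_
        filter_upwards [Lp.coeFn_smul c f] with y hy
        rw [hy, Pi.smul_apply, smul_eq_mul, smul_eq_mul]
        ring }
    ((measureUnivNNReal ν : ℝ) ^ (2 : ENNReal).toReal⁻¹ * C) (by
      intro f
      rw [mul_assoc]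
      refine Lp.norm_le_of_ae_bound (mul_nonneg hk.nonneg (norm_nonneg _)) ?_
      filter_upwards [(hk.memLp_integral f).coeFn_toLp] with x hx
      simp only [LinearMap.coe_mk, AddHom.coe_mk]
      rw [hx]
      exact hk.norm_integral_le f x)

theorem kernelOp_coeFn (hk : IsBddKernel ν k C) (f : Lp ℂ 2 ν) :
    kernelOp hk f =ᵐ[ν] fun x => ∫ y, (k x y : ℂ) * f y ∂ν :=
  (hk.memLp_integral f).coeFn_toLp

theorem isCarleman_kernelOp (hk : IsBddKernel ν k C) :
    IsCarleman (kernelOp hk) (fun x => (hk.memLp x).toLp) C :=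
  ⟨hk.norm_le, fun f => by simpa only [hk.inner_eq] using kernelOp_coeFn hk f⟩

/-- Fubini, since the kernel is real. For integrability, 2|k||f| ≤ k² + |f|² bounds the inner
integral by C′² + ‖f‖² uniformly in x, and the remaining factor |g| is integrable because the
measure is finite. -/
theorem adjoint_kernelOp {C' : ℝ} (hk : IsBddKernel ν k C)
    (hk' : IsBddKernel ν (fun x y => k y x) C') :
    (kernelOp hk).adjoint = kernelOp hk' := by
  symm
  rw [ContinuousLinearMap.eq_adjoint_iff]
  intro f g
  rw [L2.inner_def, L2.inner_def]
  have e1 : ∫ x, inner ℂ (kernelOp hk' f x) (g x) ∂ν =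
      ∫ x, ∫ y, (k y x : ℂ) * conj (f y) * g x ∂ν ∂ν := by
    refine integral_congr_ae ?_
    filter_upwards [kernelOp_coeFn hk' f] with x hx
    rw [hx, RCLike.inner_apply, ← integral_conj, ← integral_const_mul]
    refine integral_congr_ae (Eventually.of_forall fun y => ?_)
    simp only [map_mul, Complex.conj_ofReal]
    ring
  have e2 : ∫ y, inner ℂ (f y) (kernelOp hk g y) ∂ν =
      ∫ y, ∫ x, (k y x : ℂ) * conj (f y) * g x ∂ν ∂ν := by
    refine integral_congr_ae ?_
    filter_upwards [kernelOp_coeFn hk g] with y hy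
    rw [hy, RCLike.inner_apply, ← integral_mul_const]
    refine integral_congr_ae (Eventually.of_forall fun x => ?_)
    simp only
    ring
  rw [e1, e2, integral_integral_swap]
  have hm : AEStronglyMeasurable
      (Function.uncurry fun x y => (k y x : ℂ) * conj (f y) * g x) (ν.prod ν) := by
    refine StronglyMeasurable.aestronglyMeasurable ?_
    refine ((Complex.measurable_ofReal.comp hk'.measurable).stronglyMeasurable.mul
      ?_).mul ?_
    · exact (RCLike.continuous_conj.comp_stronglyMeasurable (Lp.stronglyMeasurable f)).comp_measurable
        measurable_snd
    · exact (Lp.stronglyMeasurable g).comp_measurable measurable_fst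
  have hf : Integrable (fun y => ‖f y‖ ^ 2) ν := (Lp.memLp f).integrable_norm_pow (by norm_num)
  have hk2 : ∀ x, Integrable (fun y => k y x ^ 2) ν := fun x => by
    simpa using (hk'.memLp x).integrable_norm_pow (by norm_num)
  refine (integrable_prod_iff hm).2 ⟨Eventually.of_forall fun x => ?_, ?_⟩
  · have h1 : MemLp (fun y => conj (f y)) 2 ν := (Lp.memLp f).star
    have h2 : Integrable (fun y => (k y x : ℂ) * conj (f y)) ν :=
      (hk'.memLp x).integrable_mul h1
    exact h2.mul_const (g x)
  · have h2 : ∀ x, ∫ y, ‖(k y x : ℂ) * conj (f y) * g x‖ ∂ν ≤ (C' ^ 2 + ‖f‖ ^ 2) * ‖g x‖ := by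
      intro x
      simp only [norm_mul, RCLike.norm_conj]
      rw [integral_mul_const]
      refine mul_le_mul_of_nonneg_right ?_ (norm_nonneg _)
      have h3 : ∫ y, ‖(k y x : ℂ)‖ * ‖f y‖ ∂ν ≤ ∫ y, (k y x ^ 2 + ‖f y‖ ^ 2) ∂ν := by
        refine integral_mono_of_nonneg (Eventually.of_forall fun y => by positivity)
          ((hk2 x).add hf) (Eventually.of_forall fun y => ?_)
        have h4 : ‖(k y x : ℂ)‖ ^ 2 = k y x ^ 2 := by simp
        nlinarith [sq_nonneg (‖(k y x : ℂ)‖ - ‖f y‖), sq_nonneg ‖(k y x : ℂ)‖, sq_nonneg ‖f y‖]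
      refine h3.trans ?_
      rw [integral_add (hk2 x) hf, ← norm_sq_eq_integral]
      refine add_le_add ?_ le_rfl
      have h5 : ∫ y, k y x ^ 2 ∂ν = ‖(hk'.memLp x).toLp‖ ^ 2 := by
        rw [norm_sq_eq_integral]
        refine integral_congr_ae ?_
        filter_upwards [(hk'.memLp x).coeFn_toLp] with y hy
        rw [hy]
        simp
      rw [h5]
      exact pow_le_pow_left₀ (norm_nonneg _) (hk'.norm_le x) 2
    have hg : Integrable (fun x => ‖g x‖) ν := ((Lp.memLp g).integrable (by norm_num)).norm
    refine (hg.const_mul (C' ^ 2 + ‖f‖ ^ 2)).mono' hm.norm.integral_prod_right' ?_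
    filter_upwards with x
    rw [Real.norm_of_nonneg (integral_nonneg fun _ => norm_nonneg _)]
    exact h2 x

end Kernel

/-! ### The two Volterra kernels whose product inverts Δ. -/

section VolterraKernel

theorem IsBddKernel.of_sq {X : Type} [MeasurableSpace X] {ν : Measure X} {k : X → X → ℝ} {C : ℝ}
    (hm : Measurable (Function.uncurry k)) (hC : 0 ≤ C)
    (hint : ∀ x, Integrable (fun y => k x y ^ 2) ν) (hle : ∀ x, ∫ y, k x y ^ 2 ∂ν ≤ C ^ 2) :
    IsBddKernel ν k C := by
  have hmem : ∀ x, MemLp (fun y => (k x y : ℂ)) 2 ν := fun x => by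
    refine (memLp_two_iff_integrable_sq_norm ?_).2 (by simpa using hint x)
    exact (Complex.measurable_ofReal.comp
      (hm.comp measurable_prodMk_left)).aestronglyMeasurable
  refine ⟨hm, hC, hmem, fun x => ?_⟩
  refine (sq_le_sq₀ (norm_nonneg _) hC).1 ?_
  rw [norm_sq_eq_integral]
  refine le_trans (le_of_eq (integral_congr_ae ?_)) (hle x)
  filter_upwards [(hmem x).coeFn_toLp] with y hy
  rw [hy]
  simp

/-- The Volterra kernel `α(r) β(s)` on the triangle `0 < s < r ≤ R`. -/
noncomputable def triKernel (R : ℝ) (α β : ℝ → ℝ) (r s : ℝ) : ℝ :=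
  if 0 < s ∧ s < r ∧ r ≤ R then α r * β s else 0

variable {R : ℝ} {α β : ℝ → ℝ}

theorem measurable_triKernel (hα : Measurable α) (hβ : Measurable β) :
    Measurable (Function.uncurry (triKernel R α β)) := by
  refine Measurable.ite ?_ ((hα.comp measurable_fst).mul (hβ.comp measurable_snd))
    measurable_const
  exact (measurableSet_lt measurable_const measurable_snd).inter
    ((measurableSet_lt measurable_snd measurable_fst).inter
      (measurableSet_le measurable_fst measurable_const))

theorem integral_triKernel (f : ℝ → ℂ) {r : ℝ} (hr : r ∈ Icc 0 R) :
    ∫ s in Icc 0 R, (triKernel R α β r s : ℂ) * f s = α r * ∫ s in 0..r, β s * f s := by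
  -- The triangle is open on its diagonal, so the endpoint s = r is dropped before comparing
  -- indicators.
  rw [intervalIntegral.integral_of_le hr.1, integral_Ioc_eq_integral_Ioo,
    ← integral_const_mul]
  have h : Icc 0 R ∩ Ioo 0 r = Ioo 0 r :=
    inter_eq_self_of_subset_right fun x hx => ⟨hx.1.le, hx.2.le.trans hr.2⟩
  rw [← h, ← setIntegral_indicator measurableSet_Ioo]
  refine integral_congr_ae (Eventually.of_forall fun s => ?_)
  by_cases hs : s ∈ Ioo 0 r
  · simp only [indicator_of_mem hs, triKernel, if_pos (⟨hs.1, hs.2, hr.2⟩ : 0 < s ∧ s < r ∧ r ≤ R)]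
    push_cast
    ring
  · have : ¬ (0 < s ∧ s < r ∧ r ≤ R) := fun h => hs ⟨h.1, h.2.1⟩
    simp only [indicator_of_notMem hs, triKernel, if_neg this]
    simp

theorem integral_triKernel_swap (f : ℝ → ℂ) {s : ℝ} (hs : s ∈ Ioc 0 R) :
    ∫ r in Icc 0 R, (triKernel R α β r s : ℂ) * f r = β s * ∫ r in s..R, α r * f r := by
  rw [intervalIntegral.integral_of_le hs.2, ← integral_const_mul]
  have h : Icc 0 R ∩ Ioc s R = Ioc s R :=
    inter_eq_self_of_subset_right fun x hx => ⟨hs.1.le.trans hx.1.le, hx.2⟩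
  rw [← h, ← setIntegral_indicator measurableSet_Ioc]
  refine integral_congr_ae (Eventually.of_forall fun r => ?_)
  by_cases hr : r ∈ Ioc s R
  · simp only [indicator_of_mem hr, triKernel, if_pos (⟨hs.1, hr.1, hr.2⟩ : 0 < s ∧ s < r ∧ r ≤ R)]
    push_cast
    ring
  · have : ¬ (0 < s ∧ s < r ∧ r ≤ R) := fun h => hr ⟨h.2.1, h.2.2⟩
    simp only [indicator_of_notMem hr, triKernel, if_neg this]
    simp

/-- The kernel of `g ↦ √r ∫₀ʳ g`. -/
noncomputable abbrev outerKernel (R : ℝ) : ℝ → ℝ → ℝ := triKernel R (fun r => √r) fun _ => 1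

/-- The kernel of `f ↦ -(1/s) ∫₀ˢ √t f(t) dt`. -/
noncomputable abbrev innerKernel (R : ℝ) : ℝ → ℝ → ℝ := triKernel R (fun s => -s⁻¹) fun t => √t

theorem outerKernel_sq_le (hR : 0 < R) (r s : ℝ) : outerKernel R r s ^ 2 ≤ R := by
  unfold outerKernel triKernel
  split_ifs with h
  · rw [mul_one, Real.sq_sqrt (h.1.trans h.2.1).le]
    exact h.2.2
  · simpa using hR.le

theorem isBddKernel_of_sq_le {k : ℝ → ℝ → ℝ} (hR : 0 < R)
    (hm : Measurable (Function.uncurry k)) (h : ∀ x y, k x y ^ 2 ≤ R) :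
    IsBddKernel (volume.restrict (Icc 0 R)) k R := by
  have hint : ∀ x, Integrable (fun y => k x y ^ 2) (volume.restrict (Icc 0 R)) := fun x =>
    (integrable_const R).mono' ((hm.comp measurable_prodMk_left).pow_const 2).aestronglyMeasurable
      (Eventually.of_forall fun y => by
        rw [Real.norm_of_nonneg (sq_nonneg _)]
        exact h x y)
  refine IsBddKernel.of_sq hm hR.le hint fun x => ?_
  refine (integral_mono (hint x) (integrable_const R) (h x)).trans ?_
  simp [sq, hR.le]

theorem isBddKernel_outerKernel (hR : 0 < R) :
    IsBddKernel (volume.restrict (Icc 0 R)) (outerKernel R) R :=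
  isBddKernel_of_sq_le hR (measurable_triKernel (by fun_prop) (by fun_prop)) (outerKernel_sq_le hR)

theorem isBddKernel_outerKernel_swap (hR : 0 < R) :
    IsBddKernel (volume.restrict (Icc 0 R)) (fun x y => outerKernel R y x) R :=
  isBddKernel_of_sq_le hR
    ((measurable_triKernel (R := R) (α := fun r => √r) (β := fun _ => 1)
      (by fun_prop) (by fun_prop)).comp measurable_swap) fun x y => outerKernel_sq_le hR y x

theorem measurable_innerKernel : Measurable (Function.uncurry (innerKernel R)) :=
  measurable_triKernel (by fun_prop) (by fun_prop)

/-- The singular factor 1/s is harmless: on 0 < t < s the squared kernel is t/s² ≤ 1/s, whose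
integral over an interval of length s is 1. -/
theorem isBddKernel_innerKernel (R : ℝ) :
    IsBddKernel (volume.restrict (Icc 0 R)) (innerKernel R) 1 := by
  have hle : ∀ s t, innerKernel R s t ^ 2 ≤ (Ioo 0 s).indicator (fun _ => s⁻¹) t := by
    intro s t
    unfold innerKernel triKernel
    split_ifs with h
    · have hs : 0 < s := h.1.trans h.2.1
      rw [indicator_of_mem (show t ∈ Ioo 0 s from ⟨h.1, h.2.1⟩), mul_pow, Real.sq_sqrt h.1.le,
        neg_sq, sq, mul_assoc]
      refine mul_le_of_le_one_right (inv_nonneg.2 hs.le) ?_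
      rw [inv_mul_le_iff₀ hs, mul_one]
      exact h.2.1.le
    · rw [zero_pow two_ne_zero]
      refine indicator_nonneg (fun x hx => inv_nonneg.2 (hx.1.trans hx.2).le) _
  have hi : ∀ s : ℝ, Integrable ((Ioo 0 s).indicator fun _ => s⁻¹) (volume.restrict (Icc 0 R)) :=
    fun s => (integrable_const _).indicator measurableSet_Ioo
  have hint : ∀ s, Integrable (fun t => innerKernel R s t ^ 2) (volume.restrict (Icc 0 R)) := by
    intro s
    refine (hi s).mono' ((measurable_innerKernel.comp
      measurable_prodMk_left).pow_const 2).aestronglyMeasurable (Eventually.of_forall fun t => ?_)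
    rw [Real.norm_of_nonneg (sq_nonneg _)]
    exact hle s t
  refine IsBddKernel.of_sq measurable_innerKernel zero_le_one hint fun s => ?_
  refine (integral_mono (hint s) (hi s) (hle s)).trans ?_
  rw [integral_indicator measurableSet_Ioo, setIntegral_const, smul_eq_mul, one_pow]
  rcases le_or_gt s 0 with hs | hs
  · simp [Ioo_eq_empty_of_le hs]
  · have h1 : (volume.restrict (Icc 0 R)).real (Ioo 0 s) ≤ s := by
      refine ENNReal.toReal_le_of_le_ofReal hs.le ((Measure.restrict_apply_le _ _).trans ?_)
      simp
    calc _ ≤ s * s⁻¹ := mul_le_mul_of_nonneg_right h1 (inv_nonneg.2 hs.le)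
      _ = 1 := mul_inv_cancel₀ hs.ne'

/-- For the columns, extending the integration to infinity gives ∫ t s⁻² ds over s > t, which equals
1 for t > 0. -/
theorem isBddKernel_innerKernel_swap (R : ℝ) :
    IsBddKernel (volume.restrict (Icc 0 R)) (fun x y => innerKernel R y x) 1 := by
  have hle : ∀ t s, innerKernel R s t ^ 2 ≤ (Ioi t).indicator (fun s => t * s ^ (-2 : ℝ)) s ∨ t ≤ 0 := by
    intro t s
    rcases le_or_gt t 0 with ht | ht
    · exact Or.inr ht
    left
    unfold innerKernel triKernel
    split_ifs with h
    · have hs : 0 < s := h.1.trans h.2.1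
      rw [indicator_of_mem (show s ∈ Ioi t from h.2.1), mul_pow, Real.sq_sqrt h.1.le,
        Real.rpow_neg hs.le, Real.rpow_two, neg_sq, inv_pow, mul_comm]
    · rw [zero_pow two_ne_zero]
      exact indicator_nonneg (fun x hx => mul_nonneg ht.le (Real.rpow_nonneg (ht.trans hx).le _)) _
  have hm : Measurable (Function.uncurry fun x y => innerKernel R y x) :=
    measurable_innerKernel.comp measurable_swap
  have h0 : ∀ t ≤ 0, (fun s => innerKernel R s t ^ 2) = fun _ => 0 := by
    intro t ht
    funext s
    have : ¬ (0 < t ∧ t < s ∧ s ≤ R) := fun h => absurd h.1 ht.not_gt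
    simp [innerKernel, triKernel, this]
  have hi : ∀ t : ℝ, 0 < t → Integrable ((Ioi t).indicator fun s => t * s ^ (-2 : ℝ)) := by
    intro t ht
    rw [integrable_indicator_iff measurableSet_Ioi]
    exact (integrableOn_Ioi_rpow_of_lt (by norm_num) ht).const_mul t
  have hint : ∀ t, Integrable (fun s => innerKernel R s t ^ 2) (volume.restrict (Icc 0 R)) := by
    intro t
    rcases le_or_gt t 0 with ht | ht
    · rw [h0 t ht]
      exact integrable_zero _ _ _
    refine (hi t ht).restrict.mono' ((hm.comp
      measurable_prodMk_left).pow_const 2).aestronglyMeasurable (Eventually.of_forall fun s => ?_)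
    rw [Real.norm_of_nonneg (sq_nonneg _)]
    exact (hle t s).resolve_right ht.not_ge
  refine IsBddKernel.of_sq hm zero_le_one hint fun t => ?_
  rcases le_or_gt t 0 with ht | ht
  · simp [h0 t ht]
  refine (integral_mono (hint t) (hi t ht).restrict
    fun s => (hle t s).resolve_right ht.not_ge).trans ?_
  refine (setIntegral_le_integral (hi t ht) (Eventually.of_forall fun s =>
    indicator_nonneg (fun x hx => mul_nonneg ht.le (Real.rpow_nonneg (ht.trans hx).le _)) s)).trans ?_
  rw [integral_indicator measurableSet_Ioi, integral_const_mul,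
    integral_Ioi_rpow_of_lt (by norm_num) ht]
  norm_num
  rw [Real.rpow_neg_one, mul_inv_cancel₀ ht.ne']

end VolterraKernel

/-! ### The right inverse of Δ at zero energy and its boundary behaviour. -/

section ZeroEnergy

variable {R : ℝ}

/-- `g ↦ √r ∫₀ʳ g` on `L²([0,R])`. -/
noncomputable def outerOp (hR : 0 < R) : L2Interval R →L[ℂ] L2Interval R :=
  kernelOp (isBddKernel_outerKernel hR)

/-- `f ↦ -(1/s) ∫₀ˢ √t f(t) dt` on `L²([0,R])`. -/
noncomputable def innerOp (R : ℝ) : L2Interval R →L[ℂ] L2Interval R :=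
  kernelOp (isBddKernel_innerKernel R)

/-- The right inverse of `Δ` with vanishing boundary data at `r = 0`. -/
noncomputable def zeroEnergyOp (hR : 0 < R) : L2Interval R →L[ℂ] L2Interval R :=
  outerOp hR ∘L innerOp R

/-- The boundary value at `R` of `zeroEnergyOp`, as a bounded functional. -/
noncomputable def bdryEval (hR : 0 < R) : L2Interval R →L[ℂ] ℂ :=
  innerSL ℂ ((isBddKernel_outerKernel hR).memLp R).toLp ∘L innerOp R

/-- `∫₀ˢ √t g(t) dt`, with `g` extended by zero. -/
noncomputable def innerPrim (g : L2Interval R) (s : ℝ) : ℂ :=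
  ∫ t in 0..s, (√t : ℂ) * (Icc 0 R).indicator g t

/-- The continuous representative of `zeroEnergyOp hR g`. -/
noncomputable def zeroEnergyFun (g : L2Interval R) (r : ℝ) : ℂ :=
  -(√r : ℂ) * ∫ s in 0..r, (s : ℂ)⁻¹ * innerPrim g s

theorem integrable_sqrt_mul_indicator (g : L2Interval R) :
    Integrable fun t => (√t : ℂ) * (Icc 0 R).indicator g t := by
  have h1 : (fun t => (√t : ℂ) * (Icc 0 R).indicator g t) =
      (Icc 0 R).indicator fun t => (√t : ℂ) * g t := by
    funext t
    by_cases ht : t ∈ Icc 0 R <;> simp [ht]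
  rw [h1, integrable_indicator_iff measurableSet_Icc]
  refine Integrable.bdd_mul (c := √R) ((Lp.memLp g).integrable (by norm_num))
    (by fun_prop) ?_
  filter_upwards [ae_restrict_mem measurableSet_Icc] with t ht
  rw [Complex.norm_real, Real.norm_of_nonneg (Real.sqrt_nonneg _)]
  exact Real.sqrt_le_sqrt ht.2

theorem continuous_innerPrim (g : L2Interval R) : Continuous (innerPrim g) :=
  intervalIntegral.continuous_primitive (fun _ _ => (integrable_sqrt_mul_indicator g).intervalIntegrable) 0

theorem integral_innerKernel (g : L2Interval R) {s : ℝ} (hs : s ∈ Icc 0 R) :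
    ∫ t in Icc 0 R, (innerKernel R s t : ℂ) * g t = -((s : ℂ)⁻¹ * innerPrim g s) := by
  rw [integral_triKernel _ hs]
  have : ∫ t in 0..s, (√t : ℂ) * g t = innerPrim g s := by
    refine intervalIntegral.integral_congr fun t ht => ?_
    rw [uIcc_of_le hs.1] at ht
    simp only [indicator_of_mem (show t ∈ Icc 0 R from ⟨ht.1, ht.2.trans hs.2⟩)]
  rw [this]
  push_cast
  ring

theorem innerOp_coeFn (g : L2Interval R) :
    innerOp R g =ᵐ[volume.restrict (Icc 0 R)] fun s => -((s : ℂ)⁻¹ * innerPrim g s) := by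
  filter_upwards [kernelOp_coeFn (isBddKernel_innerKernel R) g,
    ae_restrict_mem measurableSet_Icc] with s h1 h2
  exact h1.trans (integral_innerKernel g h2)

theorem integral_outerKernel_innerOp (g : L2Interval R) {r : ℝ} (hr : r ∈ Icc 0 R) :
    ∫ s in Icc 0 R, (outerKernel R r s : ℂ) * innerOp R g s = zeroEnergyFun g r := by
  have h1 : ∫ s in Icc 0 R, (outerKernel R r s : ℂ) * innerOp R g s =
      ∫ s in Icc 0 R, (outerKernel R r s : ℂ) * -((s : ℂ)⁻¹ * innerPrim g s) := by
    refine integral_congr_ae ?_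
    filter_upwards [innerOp_coeFn g] with s hs
    rw [hs]
  rw [h1, integral_triKernel (fun s => -((s : ℂ)⁻¹ * innerPrim g s)) hr, zeroEnergyFun]
  simp

theorem zeroEnergyOp_coeFn (hR : 0 < R) (g : L2Interval R) :
    zeroEnergyOp hR g =ᵐ[volume.restrict (Icc 0 R)] zeroEnergyFun g := by
  filter_upwards [kernelOp_coeFn (isBddKernel_outerKernel hR) (innerOp R g),
    ae_restrict_mem measurableSet_Icc] with r h1 h2
  exact h1.trans (integral_outerKernel_innerOp g h2)

theorem bdryEval_apply (hR : 0 < R) (g : L2Interval R) : bdryEval hR g = zeroEnergyFun g R := by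
  rw [← integral_outerKernel_innerOp g (right_mem_Icc.2 hR.le)]
  exact (isBddKernel_outerKernel hR).inner_eq R (innerOp R g)

/-- The row bound 1 of the inner kernel says that s⁻¹ times the primitive is at most ‖g‖. Beyond R
the primitive is constant, so the estimate persists there. -/
theorem norm_innerPrim_le (hR : 0 < R) (g : L2Interval R) {s : ℝ} (hs : 0 ≤ s) :
    ‖innerPrim g s‖ ≤ s * ‖g‖ := by
  have key : ∀ s ∈ Icc 0 R, ‖innerPrim g s‖ ≤ s * ‖g‖ := by
    intro s hs
    rcases hs.1.eq_or_lt with rfl | h0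
    · simp [innerPrim]
    have h1 := (isBddKernel_innerKernel R).norm_integral_le g s
    rw [integral_innerKernel g hs, norm_neg, norm_mul, norm_inv, Complex.norm_real,
      Real.norm_of_nonneg hs.1, one_mul, inv_mul_le_iff₀ h0] at h1
    exact h1
  rcases le_or_gt s R with h | h
  · exact key s ⟨hs, h⟩
  have h2 : innerPrim g s = innerPrim g R := by
    have hi := integrable_sqrt_mul_indicator g
    have h3 := intervalIntegral.integral_interval_sub_left (μ := volume)
      (hi.intervalIntegrable (a := 0) (b := s)) (hi.intervalIntegrable (a := 0) (b := R))
    have h4 : ∫ t in R..s, (√t : ℂ) * (Icc 0 R).indicator g t = 0 := by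
      rw [intervalIntegral.integral_of_le h.le]
      refine setIntegral_eq_zero_of_forall_eq_zero fun t ht => ?_
      rw [indicator_of_notMem fun h' => absurd h'.2 (not_le.2 ht.1), mul_zero]
    rw [h4] at h3
    exact sub_eq_zero.1 h3
  rw [h2]
  exact (key R (right_mem_Icc.2 hR.le)).trans
    (mul_le_mul_of_nonneg_right h.le (norm_nonneg _))

theorem norm_inv_mul_innerPrim_le (hR : 0 < R) (g : L2Interval R) {s : ℝ} (hs : 0 ≤ s) :
    ‖(s : ℂ)⁻¹ * innerPrim g s‖ ≤ ‖g‖ := by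
  rcases hs.eq_or_lt with rfl | h0
  · simp
  rw [norm_mul, norm_inv, Complex.norm_real, Real.norm_of_nonneg hs, inv_mul_le_iff₀ h0]
  exact norm_innerPrim_le hR g hs

theorem intervalIntegrable_inv_mul_innerPrim (hR : 0 < R) (g : L2Interval R) {r : ℝ} (hr : 0 ≤ r) :
    IntervalIntegrable (fun s : ℝ => (s : ℂ)⁻¹ * innerPrim g s) volume 0 r := by
  rw [intervalIntegrable_iff_integrableOn_Ioc_of_le hr]
  refine Measure.integrableOn_of_bounded (M := ‖g‖) (by simp) ?_ ?_
  · have h1 : Measurable fun s : ℝ => (s : ℂ)⁻¹ := by fun_prop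
    exact (h1.mul (continuous_innerPrim g).measurable).aestronglyMeasurable
  · filter_upwards [ae_restrict_mem measurableSet_Ioc] with s hs
    exact norm_inv_mul_innerPrim_le hR g hs.1.le

theorem norm_outerPrim_le (hR : 0 < R) (g : L2Interval R) {r : ℝ} (hr : 0 ≤ r) :
    ‖∫ s in 0..r, (s : ℂ)⁻¹ * innerPrim g s‖ ≤ r * ‖g‖ := by
  have := intervalIntegral.norm_integral_le_of_norm_le_const (a := 0) (b := r) (C := ‖g‖)
    (f := fun s : ℝ => (s : ℂ)⁻¹ * innerPrim g s) (by
      intro s hs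
      rw [uIoc_of_le hr] at hs
      exact norm_inv_mul_innerPrim_le hR g hs.1.le)
  rwa [sub_zero, abs_of_nonneg hr, mul_comm] at this

theorem norm_zeroEnergyFun_le (hR : 0 < R) (g : L2Interval R) (r : ℝ) :
    ‖zeroEnergyFun g r‖ ≤ √r * |r| * ‖g‖ := by
  rcases le_or_gt r 0 with hr | hr
  · simp [zeroEnergyFun, Real.sqrt_eq_zero_of_nonpos hr]
  · rw [zeroEnergyFun, norm_mul, norm_neg, Complex.norm_real,
      Real.norm_of_nonneg (Real.sqrt_nonneg _), abs_of_pos hr, mul_assoc]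
    exact mul_le_mul_of_nonneg_left (norm_outerPrim_le hR g hr.le) (Real.sqrt_nonneg _)

/-- The derivative of `zeroEnergyFun g`. -/
noncomputable def zeroEnergyDeriv (g : L2Interval R) (r : ℝ) : ℂ :=
  -((1 / (2 * √r) : ℝ) * (∫ s in 0..r, (s : ℂ)⁻¹ * innerPrim g s) +
    (√r : ℂ) * ((r : ℂ)⁻¹ * innerPrim g r))

theorem norm_zeroEnergyDeriv_le (hR : 0 < R) (g : L2Interval R) (r : ℝ) :
    ‖zeroEnergyDeriv g r‖ ≤ 2 * ‖g‖ * √r := by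
  rcases le_or_gt r 0 with hr | hr
  · simp [zeroEnergyDeriv, Real.sqrt_eq_zero_of_nonpos hr]
  · have hs : 0 < √r := Real.sqrt_pos.2 hr
    rw [zeroEnergyDeriv, norm_neg]
    refine (norm_add_le _ _).trans ?_
    rw [norm_mul, norm_mul, Complex.norm_real, Complex.norm_real, Real.norm_of_nonneg hs.le,
      Real.norm_of_nonneg (by positivity)]
    have h1 : 1 / (2 * √r) * ‖∫ s in 0..r, (s : ℂ)⁻¹ * innerPrim g s‖ ≤
        1 / (2 * √r) * (r * ‖g‖) :=
      mul_le_mul_of_nonneg_left (norm_outerPrim_le hR g hr.le) (by positivity)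
    have h2 : √r * ‖(r : ℂ)⁻¹ * innerPrim g r‖ ≤ √r * ‖g‖ :=
      mul_le_mul_of_nonneg_left (norm_inv_mul_innerPrim_le hR g hr.le) hs.le
    have h3 : 1 / (2 * √r) * (r * ‖g‖) = √r * ‖g‖ / 2 := by
      field_simp
      rw [Real.sq_sqrt hr.le]
    nlinarith [mul_nonneg hs.le (norm_nonneg g)]

theorem continuousAt_inv_mul_innerPrim (g : L2Interval R) {r : ℝ} (hr : r ≠ 0) :
    ContinuousAt (fun s : ℝ => (s : ℂ)⁻¹ * innerPrim g s) r :=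
  (Complex.continuous_ofReal.continuousAt.inv₀ (by exact_mod_cast hr)).mul
    (continuous_innerPrim g).continuousAt

theorem hasDerivAt_outerPrim (hR : 0 < R) (g : L2Interval R) {r : ℝ} (hr : 0 < r) :
    HasDerivAt (fun r : ℝ => ∫ s in 0..r, (s : ℂ)⁻¹ * innerPrim g s)
      ((r : ℂ)⁻¹ * innerPrim g r) r := by
  refine intervalIntegral.integral_hasDerivAt_right
    (intervalIntegrable_inv_mul_innerPrim hR g hr.le) ?_ (continuousAt_inv_mul_innerPrim g hr.ne')
  have h1 : Measurable fun s : ℝ => (s : ℂ)⁻¹ := by fun_prop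
  exact (h1.mul (continuous_innerPrim g).measurable).stronglyMeasurable.stronglyMeasurableAtFilter

theorem hasDerivAt_zeroEnergyFun (hR : 0 < R) (g : L2Interval R) (r : ℝ) :
    HasDerivAt (zeroEnergyFun g) (zeroEnergyDeriv g r) r := by
  have hsq : ∀ r : ℝ, 0 < r → HasDerivAt (fun r : ℝ => (√r : ℂ)) ((1 / (2 * √r) : ℝ) : ℂ) r :=
    fun r hr => (Real.hasDerivAt_sqrt hr.ne').ofReal_comp
  have hne : ∀ r ≠ 0, HasDerivAt (zeroEnergyFun g) (zeroEnergyDeriv g r) r := by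
    intro r hr
    rcases hr.lt_or_gt with h | h
    · have h1 : zeroEnergyFun g =ᶠ[𝓝 r] fun _ => 0 := by
        filter_upwards [Iio_mem_nhds h] with x hx
        simp [zeroEnergyFun, Real.sqrt_eq_zero_of_nonpos (le_of_lt hx)]
      have h2 : zeroEnergyDeriv g r = 0 := by
        simp [zeroEnergyDeriv, Real.sqrt_eq_zero_of_nonpos h.le]
      rw [h2]
      exact (hasDerivAt_const r (0 : ℂ)).congr_of_eventuallyEq h1
    · have := ((hsq r h).mul (hasDerivAt_outerPrim hR g h)).neg
      refine (this.congr_of_eventuallyEq (Eventually.of_forall fun x => ?_)).congr_deriv rfl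
      simp [zeroEnergyFun]
  have hlim : ∀ (f : ℝ → ℂ) (b : ℝ → ℝ), Continuous b → b 0 = 0 → (∀ r, ‖f r‖ ≤ b r) →
      ContinuousAt f 0 := by
    intro f b hb hb0 hf
    have hf0 : f 0 = 0 := norm_le_zero_iff.1 (by simpa [hb0] using hf 0)
    rw [ContinuousAt, hf0]
    exact squeeze_zero_norm hf (by simpa [hb0] using hb.tendsto 0)
  by_cases hr : r = 0
  · subst hr
    -- At 0 the derivative is recovered as a limit of nearby derivatives. To the left everything
    -- vanishes because √ does; to the right the bounds of order r^{3/2} and r^{1/2} give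
    -- continuity.
    refine hasDerivAt_of_hasDerivAt_of_ne (fun y hy => hne y hy) ?_ ?_
    · exact hlim _ _ (by fun_prop) (by simp) (norm_zeroEnergyFun_le hR g)
    · exact hlim _ _ (by fun_prop) (by simp) (norm_zeroEnergyDeriv_le hR g)
  · exact hne r hr

theorem continuous_zeroEnergyDeriv (hR : 0 < R) (g : L2Interval R) :
    Continuous (zeroEnergyDeriv g) := by
  rw [continuous_iff_continuousAt]
  intro r
  rcases lt_trichotomy r 0 with h | rfl | h
  · refine (continuousAt_const (y := (0 : ℂ))).congr ?_
    filter_upwards [Iio_mem_nhds h] with x hx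
    simp [zeroEnergyDeriv, Real.sqrt_eq_zero_of_nonpos (le_of_lt hx)]
  · have h0 : zeroEnergyDeriv g 0 = 0 := by simp [zeroEnergyDeriv]
    rw [ContinuousAt, h0]
    refine squeeze_zero_norm (norm_zeroEnergyDeriv_le hR g) ?_
    have : Continuous fun r : ℝ => 2 * ‖g‖ * √r := by fun_prop
    simpa using this.tendsto 0
  · refine ContinuousAt.neg (ContinuousAt.add (ContinuousAt.mul ?_ ?_) (ContinuousAt.mul ?_ ?_))
    · refine Complex.continuous_ofReal.continuousAt.comp ?_
      exact continuousAt_const.div (by fun_prop) (by positivity)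
    · exact (hasDerivAt_outerPrim hR g h).continuousAt
    · fun_prop
    · exact continuousAt_inv_mul_innerPrim g h.ne'

theorem hasBoundaryData_zeroEnergyOp (hR : 0 < R) (g : L2Interval R) :
    HasBoundaryData R (zeroEnergyOp hR g) 0 0 (bdryEval hR g) := by
  have hd : deriv (zeroEnergyFun g) = zeroEnergyDeriv g :=
    funext fun r => (hasDerivAt_zeroEnergyFun hR g r).deriv
  refine ⟨zeroEnergyFun g, ?_, ?_, ?_, ?_, by simp [bdryEval_apply]⟩
  · refine ContDiff.contDiffOn (contDiff_one_iff_deriv.2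
      ⟨fun r => (hasDerivAt_zeroEnergyFun hR g r).differentiableAt, ?_⟩)
    rw [hd]
    exact continuous_zeroEnergyDeriv hR g
  · refine IsBigO.of_bound ‖g‖ ?_
    filter_upwards [self_mem_nhdsWithin] with r hr
    have hr' : (0 : ℝ) < r := hr
    have h1 : r ^ (3 / 2 : ℝ) = √r * r := by
      rw [show (3 / 2 : ℝ) = 1 / 2 + 1 by norm_num, Real.rpow_add hr', Real.rpow_one,
        Real.sqrt_eq_rpow]
    rw [h1, Real.norm_of_nonneg (by positivity), mul_comm]
    simpa [abs_of_pos hr'] using norm_zeroEnergyFun_le hR g r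
  · refine IsBigO.of_bound (2 * ‖g‖) ?_
    filter_upwards [Ioo_mem_nhdsGT hR] with r hr
    rw [derivWithin_of_mem_nhds (Icc_mem_nhds hr.1 hr.2), hd, ← Real.sqrt_eq_rpow,
      Real.norm_of_nonneg (Real.sqrt_nonneg _)]
    exact norm_zeroEnergyDeriv_le hR g r
  · filter_upwards [zeroEnergyOp_coeFn hR g] with r hr
    simp [hr]

end ZeroEnergy

/-! ### The weak equation for the right inverse and for the homogeneous solutions. -/

section WeakEquation

variable {R : ℝ}

theorem IsTestFun.hasDerivAt {ξ : ℝ → ℂ} (h : IsTestFun R ξ) (r : ℝ) :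
    HasDerivAt ξ (deriv ξ r) r :=
  (h.1.differentiable (by simp) r).hasDerivAt

theorem IsTestFun.hasDerivAt_deriv {ξ : ℝ → ℂ} (h : IsTestFun R ξ) (r : ℝ) :
    HasDerivAt (deriv ξ) (deriv (deriv ξ) r) r :=
  ((contDiff_infty_iff_deriv.1 h.1).2.differentiable (by simp) r).hasDerivAt

theorem IsTestFun.continuous_deriv_deriv {ξ : ℝ → ℂ} (h : IsTestFun R ξ) :
    Continuous (deriv (deriv ξ)) :=
  (contDiff_infty_iff_deriv.1 (contDiff_infty_iff_deriv.1 h.1).2).2.continuous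

theorem IsTestFun.eq_zero_right {ξ : ℝ → ℂ} (h : IsTestFun R ξ) : ξ R = 0 :=
  image_eq_zero_of_notMem_tsupport fun h' => lt_irrefl _ (h.2.2 h').2

theorem IsTestFun.deriv_eq_zero_right {ξ : ℝ → ℂ} (h : IsTestFun R ξ) : deriv ξ R = 0 :=
  image_eq_zero_of_notMem_tsupport fun h' => lt_irrefl _ (h.2.2 (tsupport_deriv_subset h')).2

theorem hasDerivAt_ofReal_sqrt {r : ℝ} (hr : 0 < r) :
    HasDerivAt (fun r : ℝ => (√r : ℂ)) (1 / (2 * (√r : ℂ))) r := by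
  simpa using (Real.hasDerivAt_sqrt hr.ne').ofReal_comp

theorem ofReal_sqrt_sq {r : ℝ} (hr : 0 ≤ r) : (√r : ℂ) ^ 2 = r := by
  exact_mod_cast Real.sq_sqrt hr

/-- `∫ₛᴿ √r Δξ(r) dr = √s ξ'(s) - ξ(s) / (2√s)`. -/
theorem IsTestFun.integral_sqrt_mul_deltaExpr {ξ : ℝ → ℂ} (h : IsTestFun R ξ) {s : ℝ}
    (hs : s ∈ Ioc 0 R) :
    ∫ r in s..R, (√r : ℂ) * deltaExpr ξ r = √s * deriv ξ s - ξ s / (2 * √s) := by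
  have hpos : ∀ r ∈ uIcc s R, 0 < r := fun r hr => by
    rw [uIcc_of_le hs.2] at hr
    exact hs.1.trans_le hr.1
  have hd : ∀ r ∈ uIcc s R, HasDerivAt
      (fun r : ℝ => ξ r / (2 * √r) - √r * deriv ξ r) ((√r : ℂ) * deltaExpr ξ r) r := by
    intro r hr
    have hr0 := hpos r hr
    have hsq : (√r : ℂ) ≠ 0 := by exact_mod_cast (Real.sqrt_pos.2 hr0).ne'
    refine (((h.hasDerivAt r).div ((hasDerivAt_ofReal_sqrt hr0).const_mul 2) (mul_ne_zero two_ne_zero hsq)).sub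
      ((hasDerivAt_ofReal_sqrt hr0).mul (h.hasDerivAt_deriv r))).congr_deriv ?_
    rw [deltaExpr, ← ofReal_sqrt_sq hr0.le]
    field_simp
    ring
  rw [intervalIntegral.integral_eq_sub_of_hasDerivAt hd]
  · rw [h.eq_zero_right, h.deriv_eq_zero_right]
    ring
  · refine ContinuousOn.intervalIntegrable fun r hr => ContinuousAt.continuousWithinAt ?_
    have hr0 : (r : ℂ) ≠ 0 := by exact_mod_cast (hpos r hr).ne'
    refine ContinuousAt.mul (by fun_prop) (ContinuousAt.sub
      h.continuous_deriv_deriv.continuousAt.neg (h.1.continuous.continuousAt.div (by fun_prop) ?_))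
    exact mul_ne_zero (by norm_num) (pow_ne_zero 2 hr0)

/-- The integrand is the derivative of -ξ/√s, and ξ vanishes at R. This is the second of the two
integrations that undo Δ on a test function. -/
theorem IsTestFun.integral_inv_mul {ξ : ℝ → ℂ} (h : IsTestFun R ξ) {t : ℝ} (ht : t ∈ Ioc 0 R) :
    ∫ s in t..R, -(s : ℂ)⁻¹ * (√s * deriv ξ s - ξ s / (2 * √s)) = ξ t / √t := by
  have hpos : ∀ r ∈ uIcc t R, 0 < r := fun r hr => by
    rw [uIcc_of_le ht.2] at hr
    exact ht.1.trans_le hr.1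
  have hd : ∀ s ∈ uIcc t R, HasDerivAt (fun s : ℝ => -(ξ s / √s))
      (-(s : ℂ)⁻¹ * (√s * deriv ξ s - ξ s / (2 * √s))) s := by
    intro r hr
    have hr0 := hpos r hr
    have hsq : (√r : ℂ) ≠ 0 := by exact_mod_cast (Real.sqrt_pos.2 hr0).ne'
    refine ((h.hasDerivAt r).div (hasDerivAt_ofReal_sqrt hr0) hsq).neg.congr_deriv ?_
    rw [← ofReal_sqrt_sq hr0.le]
    field_simp
  rw [intervalIntegral.integral_eq_sub_of_hasDerivAt hd]
  · rw [h.eq_zero_right]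
    ring
  · refine ContinuousOn.intervalIntegrable fun r hr => ContinuousAt.continuousWithinAt ?_
    have hr0 : (r : ℂ) ≠ 0 := by exact_mod_cast (hpos r hr).ne'
    have hsq : (√r : ℂ) ≠ 0 := by exact_mod_cast (Real.sqrt_pos.2 (hpos r hr)).ne'
    have hc : Continuous (deriv ξ) := (contDiff_infty_iff_deriv.1 h.1).2.continuous
    have hc' : Continuous ξ := h.1.continuous
    refine ContinuousAt.mul (ContinuousAt.neg (ContinuousAt.inv₀ (by fun_prop) hr0))
      (ContinuousAt.sub (by fun_prop) (hc'.continuousAt.div (by fun_prop) (mul_ne_zero two_ne_zero hsq)))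

/-- The transposed kernels integrate from the right endpoint, where ξ and ξ′ vanish, so the two
integrations return ξ with no boundary terms. By duality this is the weak equation ΔVg = g. -/
theorem adjoint_zeroEnergyOp_deltaExpr (hR : 0 < R) {ξ : ℝ → ℂ} (h : IsTestFun R ξ) :
    (zeroEnergyOp hR).adjoint (h.memLp_deltaExpr.toLp) = h.memLp.toLp := by
  have hIoc : ∀ᵐ s ∂(volume.restrict (Icc (0 : ℝ) R)), s ∈ Ioc 0 R := by
    rw [← restrict_Ioc_eq_restrict_Icc]
    exact ae_restrict_mem measurableSet_Ioc
  have h1 : (outerOp hR).adjoint (h.memLp_deltaExpr.toLp) =ᵐ[volume.restrict (Icc (0 : ℝ) R)]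
      fun s => √s * deriv ξ s - ξ s / (2 * √s) := by
    rw [outerOp, adjoint_kernelOp _ (isBddKernel_outerKernel_swap hR)]
    filter_upwards [kernelOp_coeFn (isBddKernel_outerKernel_swap hR) h.memLp_deltaExpr.toLp, hIoc]
      with s hs hs'
    rw [hs, ← h.integral_sqrt_mul_deltaExpr hs']
    have := integral_triKernel_swap (R := R) (α := fun r => √r) (β := fun _ => 1)
      (deltaExpr ξ) hs'
    rw [Complex.ofReal_one, one_mul] at this
    rw [← this]
    refine integral_congr_ae ?_
    filter_upwards [h.memLp_deltaExpr.coeFn_toLp] with r hr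
    rw [hr]
  rw [zeroEnergyOp, ContinuousLinearMap.adjoint_comp, ContinuousLinearMap.comp_apply]
  refine Lp.ext ?_
  rw [innerOp, adjoint_kernelOp _ (isBddKernel_innerKernel_swap R)]
  filter_upwards [kernelOp_coeFn (isBddKernel_innerKernel_swap R)
    ((outerOp hR).adjoint (h.memLp_deltaExpr.toLp)), hIoc, h.memLp.coeFn_toLp] with t ht ht' hξ
  have h2 : ∫ s in Icc 0 R, (innerKernel R s t : ℂ) *
      (outerOp hR).adjoint (h.memLp_deltaExpr.toLp) s =
      ∫ s in Icc 0 R, (innerKernel R s t : ℂ) * (√s * deriv ξ s - ξ s / (2 * √s)) := by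
    refine integral_congr_ae ?_
    filter_upwards [h1] with s hs
    rw [hs]
  rw [ht, h2, integral_triKernel_swap _ ht', hξ]
  have h3 := h.integral_inv_mul ht'
  have hsq : (√t : ℂ) ≠ 0 := by exact_mod_cast (Real.sqrt_pos.2 ht'.1).ne'
  have h4 : ∀ s : ℝ, ((-s⁻¹ : ℝ) : ℂ) = -(s : ℂ)⁻¹ := fun s => by push_cast; rfl
  simp only [h4]
  rw [h3]
  field_simp

theorem isWeakDelta_iff {φ f : L2Interval R} :
    IsWeakDelta R φ f ↔ ∀ (ξ : ℝ → ℂ) (h : IsTestFun R ξ),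
      inner ℂ φ h.memLp_deltaExpr.toLp = inner ℂ f h.memLp.toLp := by
  have key : ∀ (g : ℝ → ℂ) (hg : MemLp g 2 (volume.restrict (Icc (0 : ℝ) R))) (u : L2Interval R),
      inner ℂ u hg.toLp = ∫ r in Icc (0 : ℝ) R, g r * conj (u r) := by
    intro g hg u
    rw [L2.inner_def]
    refine integral_congr_ae ?_
    filter_upwards [hg.coeFn_toLp] with r hr
    rw [hr, RCLike.inner_apply]
  simp only [key]
  rfl

theorem isWeakDelta_zeroEnergyOp (hR : 0 < R) (g : L2Interval R) :
    IsWeakDelta R (zeroEnergyOp hR g) g := by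
  refine isWeakDelta_iff.2 fun ξ h => ?_
  rw [← ContinuousLinearMap.adjoint_inner_right, adjoint_zeroEnergyOp_deltaExpr hR h]

/-- `r^{1/2}` and `r^{1/2} log r` solve the homogeneous equation. -/
theorem isWeakDelta_homogeneous (hR : 0 < R) {u : L2Interval R} {q : ℝ → ℝ} (a b : ℝ)
    (hq : ∀ r, q r = √r * (a + b * Real.log r))
    (hu : u =ᵐ[volume.restrict (Icc (0 : ℝ) R)] fun r => (q r : ℂ)) : IsWeakDelta R u 0 := by
  intro ξ h
  have h0 : ∫ r in Icc (0 : ℝ) R, ξ r * conj ((0 : L2Interval R) r) = 0 := by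
    refine integral_eq_zero_of_ae ?_
    filter_upwards [Lp.coeFn_zero ℂ 2 (volume.restrict (Icc (0 : ℝ) R))] with r hr
    rw [hr]
    simp
  have hqd : ∀ r : ℝ, 0 < r → HasDerivAt (fun r : ℝ => (q r : ℂ))
      ((((a + b * Real.log r) / 2 + b) / √r : ℝ) : ℂ) r := by
    intro r hr
    have hs : 0 < √r := Real.sqrt_pos.2 hr
    refine HasDerivAt.ofReal_comp ?_
    have h1 := (Real.hasDerivAt_sqrt hr.ne').mul
      (((Real.hasDerivAt_log hr.ne').const_mul b).const_add a)
    refine (h1.congr_of_eventuallyEq (Eventually.of_forall hq)).congr_deriv ?_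
    field_simp
    rw [Real.sq_sqrt hr.le]
    field_simp
  have hqdd : ∀ r : ℝ, 0 < r → HasDerivAt
      (fun r : ℝ => ((((a + b * Real.log r) / 2 + b) / √r : ℝ) : ℂ))
      (-(q r : ℂ) / (4 * (r : ℂ) ^ 2)) r := by
    intro r hr
    have hs : 0 < √r := Real.sqrt_pos.2 hr
    have h1 := ((((Real.hasDerivAt_log hr.ne').const_mul b).const_add a).div_const 2).add_const b
    have h2 := (h1.div (Real.hasDerivAt_sqrt hr.ne') hs.ne').ofReal_comp
    refine h2.congr_deriv ?_
    rw [hq]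
    have h3 : (-((√r * (a + b * Real.log r) : ℝ) : ℂ)) / (4 * (r : ℂ) ^ 2) =
      ((-(√r * (a + b * Real.log r)) / (4 * r ^ 2) : ℝ) : ℂ) := by push_cast; ring
    rw [h3]
    congr 1
    have hrs : r = √r ^ 2 := (Real.sq_sqrt hr.le).symm
    generalize Real.log r = L
    generalize √r = x at *
    subst hrs
    field_simp
    ring
  set q' : ℝ → ℂ := fun r => ((((a + b * Real.log r) / 2 + b) / √r : ℝ) : ℂ) with hq'
  -- Lagrange's identity: Δξ · q is the derivative of a Wronskian. The function q need not be
  -- differentiable at 0, but off the support of ξ the Wronskian vanishes identically nearby.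
  have hd : ∀ r ∈ uIcc 0 R, HasDerivAt (fun r => ξ r * q' r - deriv ξ r * q r)
      (deltaExpr ξ r * q r) r := by
    intro r _
    by_cases hr : r ∈ tsupport ξ
    · have hr0 := (h.2.2 hr).1
      refine (((h.hasDerivAt r).mul (hqdd r hr0)).sub
        ((h.hasDerivAt_deriv r).mul (hqd r hr0))).congr_deriv ?_
      rw [deltaExpr]
      ring
    · have e0 : ξ =ᶠ[𝓝 r] 0 := notMem_tsupport_iff_eventuallyEq.1 hr
      have e1 : deriv ξ =ᶠ[𝓝 r] 0 := by simpa using e0.deriv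
      have e2 : deriv (deriv ξ) r = 0 := by simpa using e1.deriv_eq
      have e3 : deltaExpr ξ r * q r = 0 := by
        rw [deltaExpr, e2, e0.eq_of_nhds]
        simp
      rw [e3]
      refine (hasDerivAt_const r (0 : ℂ)).congr_of_eventuallyEq ?_
      filter_upwards [e0, e1] with x h1 h2
      simp [h1, h2]
  have hcongr : (fun r => deltaExpr ξ r * conj (u r)) =ᵐ[volume.restrict (Icc (0 : ℝ) R)]
      fun r => deltaExpr ξ r * q r := by
    filter_upwards [hu] with r hr
    rw [hr, Complex.conj_ofReal]
  have hint := (integrable_mul_conj_of_memLp h.memLp_deltaExpr u).congr hcongr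
  rw [h0, integral_congr_ae hcongr, integral_Icc_eq_integral_Ioc,
    ← intervalIntegral.integral_of_le hR.le, intervalIntegral.integral_eq_sub_of_hasDerivAt hd]
  · have h1 : ξ 0 = 0 := image_eq_zero_of_notMem_tsupport fun h' => lt_irrefl _ (h.2.2 h').1
    have h2 : deriv ξ 0 = 0 :=
      image_eq_zero_of_notMem_tsupport fun h' => lt_irrefl _ (h.2.2 (tsupport_deriv_subset h')).1
    rw [h.eq_zero_right, h.deriv_eq_zero_right, h1, h2]
    ring
  · rw [intervalIntegrable_iff_integrableOn_Icc_of_le hR.le]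
    exact hint

end WeakEquation

/-! ### Quasi-nilpotence, the Neumann series and the vanishing trace. -/

section VolterraResolvent

variable {R : ℝ}

theorem mul_tsum_pow_of_summable {A : Type*} [NormedRing A] {x : A}
    (hx : Summable fun n : ℕ => x ^ n) : x * ∑' n, x ^ n = ∑' n, x ^ n - 1 := by
  have h1 := hx.hasSum.mul_left x
  have h2 := (hasSum_nat_add_iff' 1).2 hx.hasSum
  simp only [← pow_succ'] at h1
  simpa using h1.unique h2

theorem tsum_pow_mul_of_summable {A : Type*} [NormedRing A] {x : A}
    (hx : Summable fun n : ℕ => x ^ n) : (∑' n, x ^ n) * x = ∑' n, x ^ n - 1 := by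
  have h1 := hx.hasSum.mul_right x
  have h2 := (hasSum_nat_add_iff' 1).2 hx.hasSum
  simp only [← pow_succ] at h1
  simpa using h1.unique h2

/-- The inner average keeps the order s^n at the cost of √R, the outer integration gains r/(n+1),
and the prefactor costs another √R. Iterating the gain produces the factorial. -/
theorem norm_zeroEnergyFun_le_pow {f : L2Interval R} {M : ℝ} (hM : 0 ≤ M) {n : ℕ}
    (hf : ∀ᵐ t ∂(volume.restrict (Icc (0 : ℝ) R)), ‖f t‖ ≤ M * t ^ n) {r : ℝ} (hr : r ∈ Icc 0 R) :
    ‖zeroEnergyFun f r‖ ≤ M * R * (r ^ (n + 1) / (n + 1)) := by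
  have hR0 : 0 ≤ R := hr.1.trans hr.2
  have hf' : ∀ᵐ t, t ∈ Icc 0 R → ‖f t‖ ≤ M * t ^ n :=
    (ae_restrict_iff' measurableSet_Icc).1 hf
  have hP : ∀ s ∈ Icc 0 R, ‖innerPrim f s‖ ≤ √R * M * s ^ n * s := by
    intro s hs
    have h1 : ‖innerPrim f s‖ ≤ ∫ t in 0..s, √R * M * s ^ n := by
      refine intervalIntegral.norm_integral_le_of_norm_le hs.1 ?_ (by simp)
      filter_upwards [hf'] with t ht ht'
      have htR : t ∈ Icc 0 R := ⟨ht'.1.le, ht'.2.trans hs.2⟩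
      rw [indicator_of_mem htR, norm_mul, Complex.norm_real,
        Real.norm_of_nonneg (Real.sqrt_nonneg _), mul_assoc]
      refine mul_le_mul (Real.sqrt_le_sqrt htR.2) ((ht htR).trans ?_) (norm_nonneg _)
        (Real.sqrt_nonneg _)
      exact mul_le_mul_of_nonneg_left (pow_le_pow_left₀ htR.1 ht'.2 n) hM
    refine h1.trans_eq ?_
    simp
    ring
  have hQ : ‖∫ s in 0..r, (s : ℂ)⁻¹ * innerPrim f s‖ ≤ √R * M * (r ^ (n + 1) / (n + 1)) := by
    have h1 : ‖∫ s in 0..r, (s : ℂ)⁻¹ * innerPrim f s‖ ≤ ∫ s in 0..r, √R * M * s ^ n := by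
      refine intervalIntegral.norm_integral_le_of_norm_le hr.1 ?_
        (Continuous.intervalIntegrable (by fun_prop) _ _)
      filter_upwards with s hs
      rw [norm_mul, norm_inv, Complex.norm_real, Real.norm_of_nonneg hs.1.le,
        inv_mul_le_iff₀ hs.1, mul_comm]
      exact hP s ⟨hs.1.le, hs.2.trans hr.2⟩
    refine h1.trans_eq ?_
    rw [intervalIntegral.integral_const_mul, integral_pow]
    simp
  rw [zeroEnergyFun, norm_mul, norm_neg, Complex.norm_real,
    Real.norm_of_nonneg (Real.sqrt_nonneg _)]
  have h0 : 0 ≤ r ^ (n + 1) / ((n : ℝ) + 1) := div_nonneg (pow_nonneg hr.1 _) (by positivity)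
  calc _ ≤ √R * (√R * M * (r ^ (n + 1) / (n + 1))) :=
        mul_le_mul (Real.sqrt_le_sqrt hr.2) hQ (norm_nonneg _) (Real.sqrt_nonneg _)
    _ = (√R * √R) * M * (r ^ (n + 1) / (n + 1)) := by ring
    _ = _ := by rw [Real.mul_self_sqrt hR0]; ring

/-- The exponent n + 1 is there because the first application of V only converts the L² norm into a
pointwise bound; the factorial comes from the n further ones. -/
theorem norm_zeroEnergyOp_pow_apply_le (hR : 0 < R) (f : L2Interval R) (n : ℕ) :
    ∀ᵐ r ∂(volume.restrict (Icc (0 : ℝ) R)),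
      ‖(zeroEnergyOp hR ^ (n + 1)) f r‖ ≤ √R * R * ‖f‖ * (R ^ n / n.factorial) * r ^ n := by
  induction n with
  | zero =>
    filter_upwards [zeroEnergyOp_coeFn hR f, ae_restrict_mem measurableSet_Icc] with r hr hr'
    simp only [zero_add, pow_one]
    rw [hr]
    refine (norm_zeroEnergyFun_le hR f r).trans ?_
    simp only [pow_zero, Nat.factorial_zero, Nat.cast_one, div_one, mul_one]
    rw [abs_of_nonneg hr'.1]
    exact mul_le_mul_of_nonneg_right (mul_le_mul (Real.sqrt_le_sqrt hr'.2) hr'.2 hr'.1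
      (Real.sqrt_nonneg _)) (norm_nonneg _)
  | succ n ih =>
    have h1 : (zeroEnergyOp hR ^ (n + 1 + 1)) f = zeroEnergyOp hR ((zeroEnergyOp hR ^ (n + 1)) f) := by
      rw [pow_succ']
      rfl
    rw [h1]
    filter_upwards [zeroEnergyOp_coeFn hR ((zeroEnergyOp hR ^ (n + 1)) f),
      ae_restrict_mem measurableSet_Icc] with r hr hr'
    rw [hr]
    refine (norm_zeroEnergyFun_le_pow (by positivity) ih hr').trans_eq ?_
    rw [Nat.factorial_succ]
    push_cast
    field_simp
    ring

theorem norm_zeroEnergyOp_pow_le (hR : 0 < R) (n : ℕ) :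
    ‖zeroEnergyOp hR ^ (n + 1)‖ ≤
      (measureUnivNNReal (volume.restrict (Icc (0 : ℝ) R)) : ℝ) ^ (2 : ENNReal).toReal⁻¹ *
        (√R * R) * ((R * R) ^ n / n.factorial) := by
  refine ContinuousLinearMap.opNorm_le_bound _ (by positivity) fun f => ?_
  have h := Lp.norm_le_of_ae_bound (f := (zeroEnergyOp hR ^ (n + 1)) f)
    (C := √R * R * ‖f‖ * (R ^ n / n.factorial) * R ^ n) (by positivity) ?_
  · refine h.trans_eq ?_
    rw [mul_pow]
    ring
  · filter_upwards [norm_zeroEnergyOp_pow_apply_le hR f n,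
      ae_restrict_mem measurableSet_Icc] with r hr hr'
    refine hr.trans (mul_le_mul_of_nonneg_left (pow_le_pow_left₀ hr'.1 hr'.2 n) (by positivity))

theorem summable_smul_zeroEnergyOp_pow (hR : 0 < R) (z : ℂ) :
    Summable fun n : ℕ => (z • zeroEnergyOp hR) ^ n := by
  rw [← summable_nat_add_iff 1]
  refine Summable.of_norm_bounded (((Real.summable_pow_div_factorial (‖z‖ * (R * R))).mul_left
    (‖z‖ * ((measureUnivNNReal (volume.restrict (Icc (0 : ℝ) R)) : ℝ) ^ (2 : ENNReal).toReal⁻¹ *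
        (√R * R))))) fun n => ?_
  rw [smul_pow, norm_smul, norm_pow]
  refine (mul_le_mul_of_nonneg_left (norm_zeroEnergyOp_pow_le hR n) (by positivity)).trans_eq ?_
  rw [mul_pow ‖z‖]
  ring

/-- The Neumann series `(1 - z V)⁻¹` of the quasi-nilpotent operator `V = zeroEnergyOp hR`. -/
noncomputable def neumann (hR : 0 < R) (z : ℂ) : L2Interval R →L[ℂ] L2Interval R :=
  ∑' n : ℕ, (z • zeroEnergyOp hR) ^ n

theorem zeroEnergyOp_mul_neumann (hR : 0 < R) (z : ℂ) :
    (z • zeroEnergyOp hR) * neumann hR z = neumann hR z - 1 :=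
  mul_tsum_pow_of_summable (summable_smul_zeroEnergyOp_pow hR z)

theorem neumann_mul_zeroEnergyOp (hR : 0 < R) (z : ℂ) :
    neumann hR z * (z • zeroEnergyOp hR) = neumann hR z - 1 :=
  tsum_pow_mul_of_summable (summable_smul_zeroEnergyOp_pow hR z)

theorem neumann_apply (hR : 0 < R) (z : ℂ) (f : L2Interval R) :
    neumann hR z f = f + zeroEnergyOp hR (z • neumann hR z f) := by
  have := congrArg (fun T : L2Interval R →L[ℂ] L2Interval R => T f) (zeroEnergyOp_mul_neumann hR z)
  simp only [mul_apply_eq_comp, smul_apply,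
    sub_apply, one_apply_eq_self] at this
  rw [map_smul, this]
  abel

theorem neumann_apply' (hR : 0 < R) (z : ℂ) (f : L2Interval R) :
    neumann hR z (f - zeroEnergyOp hR (z • f)) = f := by
  have := congrArg (fun T : L2Interval R →L[ℂ] L2Interval R => T f) (neumann_mul_zeroEnergyOp hR z)
  simp only [mul_apply_eq_comp, smul_apply,
    sub_apply, one_apply_eq_self] at this
  rw [map_sub, map_smul, this]
  abel

theorem hasSum_neumann_apply (hR : 0 < R) (z : ℂ) (f : L2Interval R) :
    HasSum (fun n : ℕ => z ^ n • (zeroEnergyOp hR ^ n) f) (neumann hR z f) := by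
  have := (summable_smul_zeroEnergyOp_pow hR z).hasSum.mapL (ContinuousLinearMap.apply ℂ _ f)
  simp only [smul_pow] at this
  rw [neumann]
  simp only [smul_pow]
  exact this

/-- Convergence of the series for every z makes 1 - zV a unit throughout, so the derivative is that
of inversion in a Banach algebra. -/
theorem hasDerivAt_neumann (hR : 0 < R) (z : ℂ) :
    HasDerivAt (neumann hR) (neumann hR z * zeroEnergyOp hR * neumann hR z) z := by
  have hu : ∀ w, neumann hR w = Ring.inverse (1 - w • zeroEnergyOp hR) := by
    intro w
    refine (Ring.inverse_unit (⟨1 - w • zeroEnergyOp hR, neumann hR w, ?_, ?_⟩ :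
      (L2Interval R →L[ℂ] L2Interval R)ˣ)).symm
    · rw [sub_mul, one_mul, zeroEnergyOp_mul_neumann, sub_sub_cancel]
    · rw [mul_sub, mul_one, neumann_mul_zeroEnergyOp, sub_sub_cancel]
  let u : (L2Interval R →L[ℂ] L2Interval R)ˣ := ⟨1 - z • zeroEnergyOp hR, neumann hR z, by
    rw [sub_mul, one_mul, zeroEnergyOp_mul_neumann, sub_sub_cancel], by
    rw [mul_sub, mul_one, neumann_mul_zeroEnergyOp, sub_sub_cancel]⟩
  have h1 : HasDerivAt (fun w : ℂ => 1 - w • zeroEnergyOp hR) (-zeroEnergyOp hR) z := by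
    simpa using ((hasDerivAt_id z).smul_const (zeroEnergyOp hR)).const_sub 1
  have h2 := (hasFDerivAt_ringInverse (𝕜 := ℂ) u).comp_hasDerivAt z h1
  refine (h2.congr_of_eventuallyEq (Eventually.of_forall hu)).congr_deriv ?_
  simp [u]

/-- Causality: the value at r depends only on f to the left of r. This is what forces the trace to
vanish. -/
theorem zeroEnergyFun_eq_zero {f : L2Interval R} {x r : ℝ} (hr : r ∈ Icc 0 R) (hrx : r ≤ x)
    (hf : ∀ᵐ t ∂(volume.restrict (Icc (0 : ℝ) R)), t ≤ x → f t = 0) : zeroEnergyFun f r = 0 := by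
  have hf' : ∀ᵐ t, t ∈ Icc 0 R → t ≤ x → f t = 0 :=
    (ae_restrict_iff' measurableSet_Icc).1 hf
  have hP : ∀ s ∈ Icc 0 r, innerPrim f s = 0 := by
    intro s hs
    refine (intervalIntegral.integral_congr_ae ?_).trans intervalIntegral.integral_zero
    filter_upwards [hf'] with t ht ht'
    rw [uIoc_of_le hs.1] at ht'
    have htR : t ∈ Icc 0 R := ⟨ht'.1.le, ht'.2.trans (hs.2.trans hr.2)⟩
    rw [indicator_of_mem htR, ht htR (ht'.2.trans (hs.2.trans hrx)), mul_zero]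
  have hQ : ∫ s in 0..r, (s : ℂ)⁻¹ * innerPrim f s = 0 := by
    refine (intervalIntegral.integral_congr fun s hs => ?_).trans intervalIntegral.integral_zero
    rw [uIcc_of_le hr.1] at hs
    simp only [hP s hs, mul_zero]
  rw [zeroEnergyFun, hQ, mul_zero]

theorem zeroEnergyOp_pow_eq_zero (hR : 0 < R) {f : L2Interval R} {x : ℝ}
    (hf : ∀ᵐ t ∂(volume.restrict (Icc (0 : ℝ) R)), t ≤ x → f t = 0) (n : ℕ) :
    ∀ᵐ t ∂(volume.restrict (Icc (0 : ℝ) R)), t ≤ x → (zeroEnergyOp hR ^ n) f t = 0 := by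
  induction n with
  | zero => simpa using hf
  | succ n ih =>
    have h1 : (zeroEnergyOp hR ^ (n + 1)) f = zeroEnergyOp hR ((zeroEnergyOp hR ^ n) f) := by
      rw [pow_succ']
      rfl
    rw [h1]
    filter_upwards [zeroEnergyOp_coeFn hR ((zeroEnergyOp hR ^ n) f),
      ae_restrict_mem measurableSet_Icc] with r hr hr' hrx
    rw [hr, zeroEnergyFun_eq_zero hr' hrx ih]

/-- The Volterra operator `V (1 - z V)⁻¹` is trace class with vanishing trace. -/
theorem hasTrace_zeroEnergyOp_comp_neumann (hR : 0 < R) (z : ℂ) :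
    HasTrace (zeroEnergyOp hR ∘L neumann hR z) 0 := by
  have hA := isCarleman_kernelOp (isBddKernel_outerKernel hR)
  have hA' := isCarleman_kernelOp (isBddKernel_outerKernel_swap hR)
  have hB := isCarleman_kernelOp (isBddKernel_innerKernel R)
  have hB' := isCarleman_kernelOp (isBddKernel_innerKernel_swap R)
  rw [← adjoint_kernelOp (isBddKernel_outerKernel hR)] at hA'
  rw [← adjoint_kernelOp (isBddKernel_innerKernel R)] at hB'
  -- Countable bases require L² to be separable, which is where the finite exponent enters.
  have : Fact ((2 : ENNReal) ≠ ⊤) := ⟨by norm_num⟩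
  have h := hasTrace_comp_comp hA hA' hB hB' (neumann hR z)
  -- The diagonal integrand is zero: the column of the outer kernel at x lives on t > x, every power
  -- of V keeps it there, and the row of the inner kernel at x lives on t < x.
  have h0 : ∀ x, inner ℂ ((isBddKernel_innerKernel R).memLp x).toLp
      (neumann hR z ((isBddKernel_outerKernel_swap hR).memLp x).toLp) = 0 := by
    intro x
    set a := ((isBddKernel_outerKernel_swap hR).memLp x).toLp with ha
    have hsum := (hasSum_neumann_apply hR z a).mapL
      (innerSL ℂ ((isBddKernel_innerKernel R).memLp x).toLp)
    have ha0 : ∀ᵐ t ∂(volume.restrict (Icc (0 : ℝ) R)), t ≤ x → a t = 0 := by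
      filter_upwards [((isBddKernel_outerKernel_swap hR).memLp x).coeFn_toLp] with t ht htx
      rw [ht]
      have : ¬ (0 < x ∧ x < t ∧ t ≤ R) := fun h => absurd h.2.1 htx.not_gt
      simp [outerKernel, triKernel, this]
    have hz : ∀ n : ℕ, innerSL ℂ ((isBddKernel_innerKernel R).memLp x).toLp
        (z ^ n • (zeroEnergyOp hR ^ n) a) = 0 := by
      intro n
      rw [map_smul, innerSL_apply_apply, (isBddKernel_innerKernel R).inner_eq]
      rw [integral_eq_zero_of_ae, smul_zero]
      filter_upwards [zeroEnergyOp_pow_eq_zero hR ha0 n] with t ht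
      by_cases htx : t ≤ x
      · rw [ht htx, mul_zero]
        rfl
      · have : ¬ (0 < t ∧ t < x ∧ x ≤ R) := fun h => htx h.2.1.le
        simp [innerKernel, triKernel, this]
    simp only [hz] at hsum
    exact hsum.unique hasSum_zero
  simp only [h0, integral_zero] at h
  exact h

end VolterraResolvent

/-! ### The explicit power series solution and its identification with F. -/

section Bessel

variable {R : ℝ}

theorem memLp_restrict_Icc_of_continuous {f : ℝ → ℂ} (hf : Continuous f) (R : ℝ) :
    MemLp f 2 (volume.restrict (Icc (0 : ℝ) R)) := by
  obtain ⟨C, hC⟩ := (isCompact_Icc (a := (0 : ℝ)) (b := R)).exists_bound_of_continuousOn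
    hf.continuousOn
  refine MemLp.of_bound hf.aestronglyMeasurable C ?_
  filter_upwards [ae_restrict_mem measurableSet_Icc] with r hr
  exact hC r hr

theorem continuous_sqrt_mul_log : Continuous fun r : ℝ => √r * Real.log r := by
  have h : (fun r : ℝ => √r * Real.log r) = fun r => 2 * (√r * Real.log √r) := by
    funext r
    rcases le_or_gt r 0 with hr | hr
    · simp [Real.sqrt_eq_zero_of_nonpos hr]
    · rw [Real.log_sqrt hr.le]
      ring
  rw [h]
  exact continuous_const.mul (Real.continuous_mul_log.comp Real.continuous_sqrt)

/-- The coefficients in `z` of the solution of `Δφ = zφ` that behaves like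
`r^{1/2} (log r - a)` as `r → 0`. -/
noncomputable def logMode (a : ℝ) (n : ℕ) (r : ℝ) : ℝ :=
  (-1 / 4) ^ n / (n.factorial : ℝ) ^ 2 * (r ^ 2) ^ n * (√r * (Real.log r - a - (harmonic n : ℝ)))

theorem continuous_logMode (a : ℝ) (n : ℕ) : Continuous (logMode a n) := by
  have h : logMode a n = fun r => (-1 / 4) ^ n / (n.factorial : ℝ) ^ 2 * (r ^ 2) ^ n *
      (√r * Real.log r - √r * (a + (harmonic n : ℝ))) := by
    funext r
    unfold logMode
    ring
  rw [h]
  have := continuous_sqrt_mul_log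
  fun_prop

theorem memLp_logMode (R a : ℝ) (n : ℕ) :
    MemLp (fun r => (logMode a n r : ℂ)) 2 (volume.restrict (Icc (0 : ℝ) R)) :=
  memLp_restrict_Icc_of_continuous (Complex.continuous_ofReal.comp (continuous_logMode a n)) R

/-- `logMode` as an element of `L²([0,R])`. -/
noncomputable def logModeLp (R a : ℝ) (n : ℕ) : L2Interval R := (memLp_logMode R a n).toLp

theorem integral_pow_mul_log (k : ℕ) (d : ℝ) {s : ℝ} (hs : 0 ≤ s) :
    ∫ t in 0..s, t ^ (k + 1) * (Real.log t - d) =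
      s ^ (k + 2) / (k + 2) * (Real.log s - d - 1 / (k + 2)) := by
  have hc : ∀ (m : ℕ) (e : ℝ), Continuous fun t : ℝ => t ^ (m + 1) * (Real.log t - e) := by
    intro m e
    have h : (fun t : ℝ => t ^ (m + 1) * (Real.log t - e)) =
        fun t => t ^ m * (t * Real.log t) - e * t ^ (m + 1) := by
      funext t
      ring
    rw [h]
    have := Real.continuous_mul_log
    fun_prop
  have hk : (k : ℝ) + 2 ≠ 0 := by positivity
  -- Continuity at 0 comes from that of t log t, so the fundamental theorem applies with
  -- differentiability required only in the open interval.
  have h2 : Continuous fun s : ℝ => s ^ (k + 2) / (k + 2) * (Real.log s - d - 1 / (k + 2)) := by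
    have := (hc (k + 1) (d + 1 / (k + 2))).div_const ((k : ℝ) + 2)
    refine this.congr fun s => ?_
    ring
  rw [intervalIntegral.integral_eq_sub_of_hasDerivAt_of_le hs h2.continuousOn _
    ((hc k d).intervalIntegrable _ _)]
  · simp
  · intro t ht
    have h3 := (((hasDerivAt_pow (k + 2) t).div_const ((k : ℝ) + 2))).mul
      (((Real.hasDerivAt_log ht.1.ne').sub_const d).sub_const (1 / ((k : ℝ) + 2)))
    refine h3.congr_deriv ?_
    have := ht.1.ne'
    push_cast
    field_simp
    ring

theorem innerPrim_logModeLp (a : ℝ) (n : ℕ) {s : ℝ} (hs : s ∈ Icc 0 R) :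
    innerPrim (logModeLp R a n) s = ((-1 / 4) ^ n / (n.factorial : ℝ) ^ 2 *
      (s ^ (2 * n + 2) / (2 * n + 2) *
        (Real.log s - (a + (harmonic n : ℝ)) - 1 / (2 * n + 2))) : ℝ) := by
  have h1 : innerPrim (logModeLp R a n) s = ∫ t in 0..s, (((-1 / 4) ^ n / (n.factorial : ℝ) ^ 2 *
      (t ^ (2 * n + 1) * (Real.log t - (a + (harmonic n : ℝ)))) : ℝ) : ℂ) := by
    refine intervalIntegral.integral_congr_ae ?_
    have h := (ae_restrict_iff' measurableSet_Icc).1 (memLp_logMode R a n).coeFn_toLp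
    filter_upwards [h] with t ht ht'
    rw [uIoc_of_le hs.1] at ht'
    have htR : t ∈ Icc 0 R := ⟨ht'.1.le, ht'.2.trans hs.2⟩
    rw [indicator_of_mem htR, logModeLp, ht htR, ← Complex.ofReal_mul]
    congr 1
    have : √t * √t = t := Real.mul_self_sqrt htR.1
    rw [logMode, pow_succ t (2 * n), pow_mul t 2 n]
    linear_combination (-1 / 4) ^ n / (n.factorial : ℝ) ^ 2 * (t ^ 2) ^ n *
      (Real.log t - a - (harmonic n : ℝ)) * this
  rw [h1, intervalIntegral.integral_ofReal, intervalIntegral.integral_const_mul,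
    integral_pow_mul_log _ _ hs.1]
  push_cast
  rfl

/-- Each of the two integrations divides by 2n+2 and shifts the logarithm by 1/(2n+2). Together they
give the factor 1/(4(n+1)²) and the harmonic increment 1/(n+1). -/
theorem zeroEnergyFun_logModeLp (a : ℝ) (n : ℕ) {r : ℝ} (hr : r ∈ Icc 0 R) :
    zeroEnergyFun (logModeLp R a n) r = logMode a (n + 1) r := by
  have h1 : ∫ s in 0..r, (s : ℂ)⁻¹ * innerPrim (logModeLp R a n) s =
      ∫ s in 0..r, (((-1 / 4) ^ n / (n.factorial : ℝ) ^ 2 / (2 * n + 2) *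
        (s ^ (2 * n + 1) *
        (Real.log s - (a + (harmonic n : ℝ) + 1 / (2 * n + 2)))) : ℝ) : ℂ) := by
    refine intervalIntegral.integral_congr_ae (Eventually.of_forall fun s hs => ?_)
    rw [uIoc_of_le hr.1] at hs
    rw [innerPrim_logModeLp a n ⟨hs.1.le, hs.2.trans hr.2⟩, ← Complex.ofReal_inv,
      ← Complex.ofReal_mul]
    congr 1
    have := hs.1.ne'
    field_simp
    ring
  rw [zeroEnergyFun, h1, intervalIntegral.integral_ofReal, intervalIntegral.integral_const_mul,
    integral_pow_mul_log _ _ hr.1, ← Complex.ofReal_neg, ← Complex.ofReal_mul]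
  congr 1
  rw [logMode, harmonic_succ, Nat.factorial_succ]
  push_cast
  field_simp
  ring

theorem zeroEnergyOp_logModeLp (hR : 0 < R) (a : ℝ) (n : ℕ) :
    zeroEnergyOp hR (logModeLp R a n) = logModeLp R a (n + 1) := by
  refine Lp.ext ?_
  filter_upwards [zeroEnergyOp_coeFn hR (logModeLp R a n), (memLp_logMode R a (n + 1)).coeFn_toLp,
    ae_restrict_mem measurableSet_Icc] with r h1 h2 h3
  rw [h1, show logModeLp R a (n + 1) r = logMode a (n + 1) r from h2]
  exact zeroEnergyFun_logModeLp a n h3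

theorem zeroEnergyOp_pow_logModeLp (hR : 0 < R) (a : ℝ) (n : ℕ) :
    (zeroEnergyOp hR ^ n) (logModeLp R a 0) = logModeLp R a n := by
  induction n with
  | zero => simp
  | succ n ih =>
    rw [pow_succ', mul_apply_eq_comp, ih, zeroEnergyOp_logModeLp]

/-- The boundary value at `R` of the solution `neumann hR z (logModeLp R a 0)`. -/
noncomputable def bdryValue (hR : 0 < R) (a : ℝ) (z : ℂ) : ℂ :=
  logMode a 0 R + z * bdryEval hR (neumann hR z (logModeLp R a 0))

theorem hasSum_bdryValue (hR : 0 < R) (a : ℝ) (z : ℂ) :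
    HasSum (fun n : ℕ => z ^ n * (logMode a n R : ℂ)) (bdryValue hR a z) := by
  have h1 := ((hasSum_neumann_apply hR z (logModeLp R a 0)).mapL (bdryEval hR)).mul_left z
  simp only [map_smul, zeroEnergyOp_pow_logModeLp, bdryEval_apply,
    zeroEnergyFun_logModeLp a _ (right_mem_Icc.2 hR.le)] at h1
  -- The term n = 0 is the value of u₀ at R; the boundary functional applies one more V, so it
  -- accounts for the terms from 1 on.
  rw [← hasSum_nat_add_iff' 1]
  simp only [Finset.range_one, Finset.sum_singleton, pow_zero, one_mul, bdryValue,
    add_sub_cancel_left, bdryEval_apply]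
  refine h1.congr_fun fun n => ?_
  rw [smul_eq_mul, pow_succ']
  ring

/-- The product rule gives b(Nu) + z b(NVNu). Applying N to Nu = u + zVNu shows that this is b(NNu),
exactly the quantity in the trace of the rank one part of the resolvent. -/
theorem hasDerivAt_bdryValue (hR : 0 < R) (a : ℝ) (z : ℂ) :
    HasDerivAt (bdryValue hR a)
      (bdryEval hR (neumann hR z (neumann hR z (logModeLp R a 0)))) z := by
  unfold bdryValue
  generalize logModeLp R a 0 = u
  have h0 : HasDerivAt (fun w => neumann hR w u)
      ((neumann hR z * zeroEnergyOp hR * neumann hR z) u) z := by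
    simpa only [map_zero, add_zero] using
      (hasDerivAt_neumann hR z).clm_apply (hasDerivAt_const z u)
  have h1 : HasDerivAt (fun w => bdryEval hR (neumann hR w u))
      (bdryEval hR ((neumann hR z * zeroEnergyOp hR * neumann hR z) u)) z :=
    (bdryEval hR).hasFDerivAt.comp_hasDerivAt z h0
  have h2 := ((hasDerivAt_id z).mul h1).const_add (logMode a 0 R : ℂ)
  refine h2.congr_deriv ?_
  have h3 : neumann hR z (neumann hR z u) = neumann hR z u +
      z • (neumann hR z * zeroEnergyOp hR * neumann hR z) u := by
    conv_lhs => rw [neumann_apply hR z u, map_add]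
    simp [mul_apply_eq_comp]
  rw [h3, map_add, map_smul]
  simp

theorem summable_besselJZero (w : ℂ) :
    Summable fun k : ℕ => w ^ k / ((k.factorial : ℂ) ^ 2) := by
  refine Summable.of_norm_bounded (Real.summable_pow_div_factorial ‖w‖) fun k => ?_
  rw [norm_div, norm_pow, norm_pow, Complex.norm_natCast]
  have h1 : (1 : ℝ) ≤ k.factorial := by exact_mod_cast k.factorial_pos
  refine div_le_div_of_nonneg_left (by positivity) (by positivity) ?_
  nlinarith

/-- Since R > 0, log(μR) = log μ + log R for principal branches, so log μ, log 2 and γ all cancel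
against κ. What is left is (2/π)((log R - tan θ) J₀ - Σ H_k …), whose terms are the solution
coefficients at R divided by √R. -/
theorem charF_eq (hR : 0 < R) (θ : ℝ) {μ : ℂ} (hμ : μ ≠ 0) :
    charF R θ μ = 2 / (Real.pi : ℂ) / √R * bdryValue hR (Real.tan θ) (μ ^ 2) := by
  have hJ := (summable_besselJZero (-((μ * R) ^ 2) / 4)).hasSum
  have hB := hasSum_bdryValue hR (Real.tan θ) (μ ^ 2)
  have hs : (√R : ℂ) ≠ 0 := by exact_mod_cast (Real.sqrt_pos.2 hR).ne'
  have hS : HasSum (fun k : ℕ => ((harmonic k : ℚ) : ℂ) * (-((μ * R) ^ 2) / 4) ^ k /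
      ((k.factorial : ℂ) ^ 2))
      ((Real.log R - Real.tan θ : ℝ) * besselJZero (μ * R) -
        bdryValue hR (Real.tan θ) (μ ^ 2) / √R) := by
    refine ((hJ.mul_left ((Real.log R - Real.tan θ : ℝ) : ℂ)).sub
      (hB.div_const (√R : ℂ))).congr_fun fun k => ?_
    have e1 : (-((μ * R) ^ 2) / 4) ^ k = (-1 / 4) ^ k * ((R : ℂ) ^ 2) ^ k * (μ ^ 2) ^ k := by
      rw [← mul_pow, ← mul_pow]
      congr 1
      ring
    have hf : (k.factorial : ℂ) ≠ 0 := by exact_mod_cast k.factorial_ne_zero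
    rw [e1, logMode]
    push_cast
    field_simp
    ring
  rw [charF, besselYZero, hS.tsum_eq, kappaConst, Complex.log_mul_ofReal R hR μ hμ]
  push_cast
  field_simp
  ring

end Bessel

/-! ### Uniqueness of the boundary coefficients. -/

section BoundaryDataUnique

variable {R : ℝ}

theorem HasBoundaryData.eq_zero (hR : 0 < R) {c₁ c₂ b : ℂ} (h : HasBoundaryData R 0 c₁ c₂ b) :
    c₁ = 0 ∧ c₂ = 0 ∧ b = 0 := by
  obtain ⟨ψ, h1, h2, -, h4, h5⟩ := h
  have hcont : ContinuousOn
      (fun r : ℝ => c₁ * (√r : ℝ) + c₂ * (√r * Real.log r : ℝ) + ψ r) (Icc 0 R) := by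
    have hlog := Complex.continuous_ofReal.comp continuous_sqrt_mul_log
    have hsq : Continuous fun r : ℝ => c₁ * (√r : ℝ) := by fun_prop
    exact ((hsq.add (continuous_const.mul hlog)).continuousOn).add h1.continuousOn
  have hz : EqOn (fun r : ℝ => c₁ * (√r : ℝ) + c₂ * (√r * Real.log r : ℝ) + ψ r)
      (fun _ => 0) (Icc 0 R) := by
    refine Measure.eqOn_Icc_of_ae_eq volume hR.ne ?_ hcont continuousOn_const
    filter_upwards [h4, Lp.coeFn_zero ℂ 2 (volume.restrict (Icc (0 : ℝ) R))] with r hr hr'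
    rw [← hr, hr']
    rfl
  -- The remainder equals -√r(c₁ + c₂ log r) and is O(r^{3/2}), so the bracket is O(r). Dividing by
  -- log r then isolates c₂, and c₁ follows.
  have hlim : Tendsto (fun r : ℝ => c₁ + c₂ * (Real.log r : ℂ)) (𝓝[>] 0) (𝓝 0) := by
    obtain ⟨C, hC⟩ := h2.bound
    have hC0 : Tendsto (fun r : ℝ => C * r) (𝓝[>] 0) (𝓝 0) := by
      have : Tendsto (fun r : ℝ => C * r) (𝓝 0) (𝓝 (C * 0)) :=
        (continuous_const.mul continuous_id).tendsto 0
      rw [mul_zero] at this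
      exact this.mono_left nhdsWithin_le_nhds
    refine squeeze_zero_norm' ?_ hC0
    filter_upwards [hC, Ioo_mem_nhdsGT hR] with r hr hr'
    have hs : 0 < √r := Real.sqrt_pos.2 hr'.1
    have e1 : ψ r = -((√r : ℂ) * (c₁ + c₂ * (Real.log r : ℂ))) := by
      have := hz ⟨hr'.1.le, hr'.2.le⟩
      simp only [Complex.ofReal_mul] at this
      linear_combination this
    have e2 : r ^ (3 / 2 : ℝ) = √r * r := by
      rw [show (3 / 2 : ℝ) = 1 / 2 + 1 by norm_num, Real.rpow_add hr'.1, Real.rpow_one,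
        Real.sqrt_eq_rpow]
    rw [e1, e2, norm_neg, norm_mul, Complex.norm_real, Real.norm_of_nonneg hs.le,
      Real.norm_of_nonneg (mul_pos hs hr'.1).le] at hr
    refine le_of_mul_le_mul_left (hr.trans_eq ?_) hs
    ring
  have hc2 : c₂ = 0 := by
    have hl : Tendsto (fun r : ℝ => ((Real.log r : ℝ) : ℂ)⁻¹) (𝓝[>] 0) (𝓝 0) := by
      have := (tendsto_inv_atBot_zero.comp Real.tendsto_log_nhdsGT_zero).ofReal
      simpa [Function.comp_def] using this
    have h6 := hlim.mul hl
    have h7 : Tendsto (fun r : ℝ => c₁ * ((Real.log r : ℝ) : ℂ)⁻¹ + c₂) (𝓝[>] 0)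
        (𝓝 (c₁ * 0 + c₂)) := (hl.const_mul c₁).add_const c₂
    have h8 : (fun r : ℝ => (c₁ + c₂ * (Real.log r : ℂ)) * ((Real.log r : ℝ) : ℂ)⁻¹) =ᶠ[𝓝[>] 0]
        fun r : ℝ => c₁ * ((Real.log r : ℝ) : ℂ)⁻¹ + c₂ := by
      filter_upwards [Ioo_mem_nhdsGT one_pos] with r hr
      have : (Real.log r : ℂ) ≠ 0 := by exact_mod_cast (Real.log_neg hr.1 hr.2).ne
      field_simp
    have := tendsto_nhds_unique (h6.congr' h8) h7
    simpa using this.symm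
  subst hc2
  have hc1 : c₁ = 0 := by
    simp only [zero_mul, add_zero] at hlim
    exact tendsto_nhds_unique tendsto_const_nhds hlim
  refine ⟨hc1, rfl, ?_⟩
  rw [h5]
  exact hz (right_mem_Icc.2 hR.le)

theorem HasBoundaryData.unique (hR : 0 < R) {φ : L2Interval R} {c₁ c₂ b c₁' c₂' b' : ℂ}
    (h : HasBoundaryData R φ c₁ c₂ b) (h' : HasBoundaryData R φ c₁' c₂' b') :
    c₁ = c₁' ∧ c₂ = c₂' ∧ b = b' := by
  have h0 := h.add hR (h'.smul (-1))
  rw [neg_one_smul, add_neg_cancel] at h0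
  obtain ⟨h1, h2, h3⟩ := h0.eq_zero hR
  simp only [neg_one_mul] at h1 h2 h3
  exact ⟨add_neg_eq_zero.1 h1, add_neg_eq_zero.1 h2, add_neg_eq_zero.1 h3⟩

end BoundaryDataUnique

/-! ### Weak solutions of the homogeneous equation. -/

section WeakKernel

variable {R : ℝ}

/-- Smooth functions that vanish to the left of some positive number. -/
def SmoothVanishLeft (f : ℝ → ℂ) : Prop :=
  ContDiff ℝ ∞ f ∧ ∃ ε > 0, ∀ r < ε, f r = 0

/-- Vanishing near 0 hides the singularity there of weights such as √r or log r, which are smooth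
only for r > 0. -/
theorem SmoothVanishLeft.mul {f w : ℝ → ℂ} (hf : SmoothVanishLeft f)
    (hw : ContDiffOn ℝ ∞ w (Ioi 0)) : SmoothVanishLeft fun r => w r * f r := by
  obtain ⟨h1, ε, hε, h2⟩ := hf
  refine ⟨contDiff_iff_contDiffAt.2 fun r => ?_, ε, hε, fun r hr => by simp [h2 r hr]⟩
  rcases lt_or_ge r ε with hr | hr
  · refine (contDiffAt_const (c := (0 : ℂ))).congr_of_eventuallyEq ?_
    filter_upwards [Iio_mem_nhds hr] with x hx
    rw [h2 x hx, mul_zero]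
  · exact (hw.contDiffAt (Ioi_mem_nhds (hε.trans_le hr))).mul h1.contDiffAt

theorem SmoothVanishLeft.hasDerivAt_prim {f : ℝ → ℂ} (hf : SmoothVanishLeft f) (r : ℝ) :
    HasDerivAt (fun r => ∫ t in 0..r, f t) (f r) r :=
  intervalIntegral.integral_hasDerivAt_right (hf.1.continuous.intervalIntegrable _ _)
    (hf.1.continuous.stronglyMeasurableAtFilter _ _) hf.1.continuous.continuousAt

theorem SmoothVanishLeft.prim {f : ℝ → ℂ} (hf : SmoothVanishLeft f) :
    SmoothVanishLeft fun r => ∫ t in 0..r, f t := by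
  refine ⟨contDiff_infty_iff_deriv.2 ⟨fun r => (hf.hasDerivAt_prim r).differentiableAt, ?_⟩, ?_⟩
  · rw [funext fun r => (hf.hasDerivAt_prim r).deriv]
    exact hf.1
  · obtain ⟨ε, hε, h2⟩ := hf.2
    refine ⟨ε, hε, fun r hr => ?_⟩
    refine (intervalIntegral.integral_congr fun t ht => h2 t ?_).trans
      intervalIntegral.integral_zero
    exact ht.2.trans_lt (max_lt hε hr)

theorem SmoothVanishLeft.sub {f g : ℝ → ℂ} (hf : SmoothVanishLeft f) (hg : SmoothVanishLeft g) :
    SmoothVanishLeft fun r => f r - g r := by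
  obtain ⟨h1, ε, hε, h2⟩ := hf
  obtain ⟨h1', ε', hε', h2'⟩ := hg
  refine ⟨h1.sub h1', min ε ε', lt_min hε hε', fun r hr => ?_⟩
  simp [h2 r (hr.trans_le (min_le_left _ _)), h2' r (hr.trans_le (min_le_right _ _))]

theorem SmoothVanishLeft.const_mul {f : ℝ → ℂ} (hf : SmoothVanishLeft f) (c : ℂ) :
    SmoothVanishLeft fun r => c * f r :=
  hf.mul contDiffOn_const

theorem SmoothVanishLeft.continuous_deltaExpr {f : ℝ → ℂ} (hf : SmoothVanishLeft f) :
    Continuous (deltaExpr f) := by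
  have h1 : ContDiffOn ℝ ∞ (fun r : ℝ => (1 : ℂ) / (4 * (r : ℂ) ^ 2)) (Ioi 0) := by
    have h4 : ContDiff ℝ ∞ fun r : ℝ => (4 : ℂ) * (r : ℂ) ^ 2 :=
      contDiff_const.mul (Complex.ofRealCLM.contDiff.pow 2)
    simp only [one_div]
    refine h4.contDiffOn.inv fun r hr => ?_
    have : (r : ℂ) ≠ 0 := by exact_mod_cast (ne_of_gt hr)
    exact mul_ne_zero (by norm_num) (pow_ne_zero 2 this)
  have h2 := (contDiff_infty_iff_deriv.1 (contDiff_infty_iff_deriv.1 hf.1).2).2.continuous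
  have h3 := (hf.mul h1).1.continuous
  refine (h2.neg.sub h3).congr fun r => ?_
  simp only [Pi.sub_apply, Pi.neg_apply, deltaExpr, one_div_mul_eq_div]

theorem deltaExpr_sub {f g : ℝ → ℂ} (hf : ContDiff ℝ ∞ f) (hg : ContDiff ℝ ∞ g) (r : ℝ) :
    deltaExpr (fun r => f r - g r) r = deltaExpr f r - deltaExpr g r := by
  have hd : ∀ {f g : ℝ → ℂ}, ContDiff ℝ ∞ f → ContDiff ℝ ∞ g →
      deriv (fun r => f r - g r) = fun r => deriv f r - deriv g r := fun hf hg =>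
    funext fun r => deriv_fun_sub (hf.differentiable (by simp) r) (hg.differentiable (by simp) r)
  rw [deltaExpr, hd hf hg, hd (contDiff_infty_iff_deriv.1 hf).2 (contDiff_infty_iff_deriv.1 hg).2,
    deltaExpr, deltaExpr]
  ring

theorem deltaExpr_const_mul (c : ℂ) (f : ℝ → ℂ) (r : ℝ) :
    deltaExpr (fun r => c * f r) r = c * deltaExpr f r := by
  have hd : ∀ f : ℝ → ℂ, deriv (fun r => c * f r) = fun r => c * deriv f r := fun f =>
    funext fun r => deriv_const_mul_field c
  rw [deltaExpr, hd, hd, deltaExpr]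
  ring

theorem contDiffOn_ofReal_sqrt : ContDiffOn ℝ ∞ (fun r : ℝ => (√r : ℂ)) (Ioi 0) :=
  Complex.ofRealCLM.contDiff.comp_contDiffOn fun _ hr =>
    (Real.contDiffAt_sqrt (ne_of_gt hr)).contDiffWithinAt

theorem contDiffOn_ofReal_sqrt_mul_log :
    ContDiffOn ℝ ∞ (fun r : ℝ => ((√r * Real.log r : ℝ) : ℂ)) (Ioi 0) :=
  Complex.ofRealCLM.contDiff.comp_contDiffOn fun _ hr =>
    ((Real.contDiffAt_sqrt (ne_of_gt hr)).mul
      (Real.contDiffAt_log.2 (ne_of_gt hr))).contDiffWithinAt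

theorem IsTestFun.exists_bounds (hR : 0 < R) {ξ : ℝ → ℂ} (h : IsTestFun R ξ) :
    ∃ ε ρ, 0 < ε ∧ ρ < R ∧ (∀ r < ε, ξ r = 0) ∧ ∀ r, ρ < r → ξ r = 0 := by
  have hK : IsCompact (tsupport ξ) := h.2.1
  rcases (tsupport ξ).eq_empty_or_nonempty with h0 | h0
  · have : ∀ r, ξ r = 0 := fun r => image_eq_zero_of_notMem_tsupport (by simp [h0])
    exact ⟨R, 0, hR, hR, fun r _ => this r, fun r _ => this r⟩
  · obtain ⟨ε, hε, h1⟩ := hK.exists_isLeast h0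
    obtain ⟨ρ, hρ, h2⟩ := hK.exists_isGreatest h0
    exact ⟨ε, ρ, (h.2.2 hε).1, (h.2.2 hρ).2,
      fun r hr => image_eq_zero_of_notMem_tsupport fun h' => (h1 h').not_gt hr,
      fun r hr => image_eq_zero_of_notMem_tsupport fun h' => (h2 h').not_gt hr⟩

theorem SmoothVanishLeft.isTestFun {f : ℝ → ℂ} (hf : SmoothVanishLeft f) {ρ : ℝ} (hρ : ρ < R)
    (h : ∀ r, ρ < r → f r = 0) : IsTestFun R f := by
  obtain ⟨h1, ε, hε, h2⟩ := hf
  have hs : tsupport f ⊆ Icc ε ρ := by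
    refine closure_minimal (fun r hr => ⟨?_, ?_⟩) isClosed_Icc
    · by_contra h'
      exact hr (h2 r (not_le.1 h'))
    · by_contra h'
      exact hr (h r (not_le.1 h'))
  exact ⟨h1, isCompact_Icc.of_isClosed_subset (isClosed_tsupport f) hs,
    hs.trans fun r hr => ⟨hε.trans_le hr.1, hr.2.trans_lt hρ⟩⟩

/-- A smooth cutoff, `0` near `r ≤ 0` and `1` near `R`. -/
noncomputable def cutoff (R : ℝ) (r : ℝ) : ℂ := (Real.smoothTransition (3 * r / R - 1) : ℂ)

theorem smoothVanishLeft_cutoff (hR : 0 < R) : SmoothVanishLeft (cutoff R) := by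
  refine ⟨Complex.ofRealCLM.contDiff.comp (Real.smoothTransition.contDiff.comp (by fun_prop)),
    R / 3, by positivity, fun r hr => ?_⟩
  have : 3 * r / R - 1 ≤ 0 := by
    rw [sub_nonpos, div_le_one hR]
    linarith
  simp [cutoff, Real.smoothTransition.zero_of_nonpos this]

theorem cutoff_eq_one (hR : 0 < R) {r : ℝ} (hr : 2 * R / 3 < r) : cutoff R r = 1 := by
  have : 1 ≤ 3 * r / R - 1 := by
    rw [le_sub_iff_add_le, le_div_iff₀ hR]
    linarith
  simp [cutoff, Real.smoothTransition.one_of_one_le this]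

/-- Variation of constants: `√r ∫₀ʳ √t log t ζ - √r log r ∫₀ʳ √t ζ` solves `Δu = ζ`. -/
theorem deltaExpr_variation {ζ : ℝ → ℂ} (hζ : SmoothVanishLeft ζ) {r : ℝ} (hr : 0 < r) :
    deltaExpr (fun r : ℝ => (√r : ℂ) * (∫ t in 0..r, ((√t * Real.log t : ℝ) : ℂ) * ζ t) -
      ((√r * Real.log r : ℝ) : ℂ) * ∫ t in 0..r, (√t : ℂ) * ζ t) r = ζ r := by
  have hA := (hζ.mul contDiffOn_ofReal_sqrt_mul_log).hasDerivAt_prim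
  have hP := (hζ.mul contDiffOn_ofReal_sqrt).hasDerivAt_prim
  set A : ℝ → ℂ := fun r => ∫ t in 0..r, ((√t * Real.log t : ℝ) : ℂ) * ζ t
  set P : ℝ → ℂ := fun r => ∫ t in 0..r, (√t : ℂ) * ζ t
  have hl : ∀ r : ℝ, 0 < r → HasDerivAt (fun r : ℝ => (Real.log r : ℂ)) ((r : ℂ)⁻¹) r :=
    fun r hr => by simpa using (Real.hasDerivAt_log hr.ne').ofReal_comp
  have h1 : ∀ r : ℝ, 0 < r → HasDerivAt
      (fun r : ℝ => (√r : ℂ) * A r - ((√r * Real.log r : ℝ) : ℂ) * P r)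
      ((A r - ((Real.log r : ℂ) + 2) * P r) / (2 * √r)) r := by
    intro r hr
    have hs : (√r : ℂ) ≠ 0 := by exact_mod_cast (Real.sqrt_pos.2 hr).ne'
    have h2 := ((hasDerivAt_ofReal_sqrt hr).mul (hA r)).sub
      (((hasDerivAt_ofReal_sqrt hr).mul (hl r hr)).mul (hP r))
    refine (h2.congr_of_eventuallyEq (Eventually.of_forall fun x => ?_)).congr_deriv ?_
    · simp
    · simp only [Pi.mul_apply]
      rw [← ofReal_sqrt_sq hr.le]
      push_cast
      field_simp
      ring
  have hs : (√r : ℂ) ≠ 0 := by exact_mod_cast (Real.sqrt_pos.2 hr).ne'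
  have h3 := ((hA r).sub (((hl r hr).add_const 2).mul (hP r))).div
    ((hasDerivAt_ofReal_sqrt hr).const_mul 2) (mul_ne_zero two_ne_zero hs)
  have h4 : deriv (fun r : ℝ => (√r : ℂ) * A r - ((√r * Real.log r : ℝ) : ℂ) * P r) =ᶠ[𝓝 r]
      fun r => (A r - ((Real.log r : ℂ) + 2) * P r) / (2 * √r) := by
    filter_upwards [Ioi_mem_nhds hr] with x hx
    exact (h1 x hx).deriv
  change deltaExpr (fun r : ℝ => (√r : ℂ) * A r - ((√r * Real.log r : ℝ) : ℂ) * P r) r = ζ r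
  rw [deltaExpr, (h3.congr_of_eventuallyEq h4).deriv, ← ofReal_sqrt_sq hr.le]
  push_cast
  simp only [Pi.sub_apply, Pi.mul_apply]
  field_simp
  ring

/-- The variation of constants solution vanishes near 0 but near R equals a√r - p√r log r, with a
and p the two moments of ζ. Subtracting a cutoff of this combination makes it a test function. So
test functions lie in the range of Δ modulo two fixed functions, whose coefficients are those
moments. -/
theorem IsTestFun.exists_deltaExpr_eq (hR : 0 < R) {ζ : ℝ → ℂ} (h : IsTestFun R ζ) :
    ∃ ξ, IsTestFun R ξ ∧ ∀ r : ℝ, 0 < r → deltaExpr ξ r = ζ r -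
      ((∫ t in 0..R, ((√t * Real.log t : ℝ) : ℂ) * ζ t) *
          deltaExpr (fun r : ℝ => (√r : ℂ) * cutoff R r) r -
        (∫ t in 0..R, (√t : ℂ) * ζ t) *
          deltaExpr (fun r : ℝ => ((√r * Real.log r : ℝ) : ℂ) * cutoff R r) r) := by
  obtain ⟨ε, ρ, hε, hρ, h1, h2⟩ := h.exists_bounds hR
  have hζ : SmoothVanishLeft ζ := ⟨h.1, ε, hε, h1⟩
  set a := ∫ t in 0..R, ((√t * Real.log t : ℝ) : ℂ) * ζ t with ha
  set p := ∫ t in 0..R, (√t : ℂ) * ζ t with hp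
  have hA := hζ.mul contDiffOn_ofReal_sqrt_mul_log
  have hP := hζ.mul contDiffOn_ofReal_sqrt
  have hX := smoothVanishLeft_cutoff hR
  have hu := (hA.prim.mul contDiffOn_ofReal_sqrt).sub (hP.prim.mul contDiffOn_ofReal_sqrt_mul_log)
  have hX1 := (hX.mul contDiffOn_ofReal_sqrt).const_mul a
  have hX2 := (hX.mul contDiffOn_ofReal_sqrt_mul_log).const_mul p
  have htail : ∀ w : ℝ → ℂ, SmoothVanishLeft (fun t => w t * ζ t) → ∀ r, ρ < r →
      ∫ t in 0..r, w t * ζ t = ∫ t in 0..R, w t * ζ t := by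
    intro w hw r hr
    have hi := fun x y => hw.1.continuous.intervalIntegrable (μ := volume) x y
    rw [← sub_eq_zero, intervalIntegral.integral_interval_sub_left (hi _ _) (hi _ _)]
    refine (intervalIntegral.integral_congr fun t ht => ?_).trans intervalIntegral.integral_zero
    simp only [h2 t ((lt_min hρ hr).trans_le ht.1), mul_zero]
  refine ⟨_, (hu.sub (hX1.sub hX2)).isTestFun (max_lt hρ (by linarith : 2 * R / 3 < R))
    fun r hr => ?_, fun r hr => ?_⟩
  · rw [htail _ hA r ((le_max_left _ _).trans_lt hr), htail _ hP r ((le_max_left _ _).trans_lt hr),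
      cutoff_eq_one hR ((le_max_right _ _).trans_lt hr)]
    ring
  · rw [deltaExpr_sub hu.1 (hX1.sub hX2).1, deltaExpr_sub hX1.1 hX2.1, deltaExpr_variation hζ hr,
      deltaExpr_const_mul, deltaExpr_const_mul]

/-- Weak `L²` solutions of the homogeneous equation are combinations of `r^{1/2}` and
`r^{1/2} log r`. -/
theorem exists_eq_of_isWeakDelta_zero (hR : 0 < R) {h : L2Interval R} (hh : IsWeakDelta R h 0) :
    ∃ a b : ℂ, h =ᵐ[volume.restrict (Icc (0 : ℝ) R)]
      fun r => a * (√r : ℝ) + b * (√r * Real.log r : ℝ) := by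
  have hX := smoothVanishLeft_cutoff hR
  set D₁ := deltaExpr (fun r : ℝ => (√r : ℂ) * cutoff R r) with hD₁
  set D₂ := deltaExpr (fun r : ℝ => ((√r * Real.log r : ℝ) : ℂ) * cutoff R r) with hD₂
  have hi₁ := integrable_mul_conj_of_memLp (memLp_restrict_Icc_of_continuous
    (hX.mul contDiffOn_ofReal_sqrt).continuous_deltaExpr R) h
  have hi₂ := integrable_mul_conj_of_memLp (memLp_restrict_Icc_of_continuous
    (hX.mul contDiffOn_ofReal_sqrt_mul_log).continuous_deltaExpr R) h
  rw [← hD₁] at hi₁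
  rw [← hD₂] at hi₂
  set d₁ := ∫ r in Icc 0 R, D₁ r * conj (h r)
  set d₂ := ∫ r in Icc 0 R, D₂ r * conj (h r)
  have hIoc : ∀ᵐ s ∂(volume.restrict (Icc (0 : ℝ) R)), s ∈ Ioc 0 R := by
    rw [← restrict_Ioc_eq_restrict_Icc]
    exact ae_restrict_mem measurableSet_Ioc
  have hIoo : ∀ᵐ s ∂(volume.restrict (Icc (0 : ℝ) R)), s ∈ Ioo 0 R := by
    rw [← restrict_Ioo_eq_restrict_Icc]
    exact ae_restrict_mem measurableSet_Ioo
  have hc₂ : Continuous fun r : ℝ => ((√r * Real.log r : ℝ) : ℂ) :=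
    Complex.continuous_ofReal.comp continuous_sqrt_mul_log
  have hc₁ : Continuous fun r : ℝ => (√r : ℂ) := by fun_prop
  -- Testing the weak equation with ξ leaves only the moments of ζ paired with `d₁` and `d₂`; this
  -- reads as conj h minus a fixed combination being orthogonal to ζ.
  have key : ∀ ζ, IsTestFun R ζ → ∫ r in Icc (0 : ℝ) R,
      ζ r * (conj (h r) - (d₁ * ((√r * Real.log r : ℝ) : ℂ) - d₂ * (√r : ℂ))) = 0 := by
    intro ζ hζ
    obtain ⟨ξ, hξ, he⟩ := hζ.exists_deltaExpr_eq hR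
    have e0 := hh ξ hξ
    have e1 : ∫ r in Icc (0 : ℝ) R, ξ r * conj ((0 : L2Interval R) r) = 0 := by
      refine integral_eq_zero_of_ae ?_
      filter_upwards [Lp.coeFn_zero ℂ 2 (volume.restrict (Icc (0 : ℝ) R))] with r hr
      rw [hr]
      simp
    have hconv : ∀ w : ℝ → ℂ, ∫ t in 0..R, w t * ζ t = ∫ t in Icc 0 R, w t * ζ t := fun w => by
      rw [intervalIntegral.integral_of_le hR.le, integral_Icc_eq_integral_Ioc]
    rw [hconv, hconv] at he
    set a := ∫ t in Icc 0 R, ((√t * Real.log t : ℝ) : ℂ) * ζ t with ha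
    set p := ∫ t in Icc 0 R, (√t : ℂ) * ζ t with hp
    have hζi := integrable_mul_conj_of_memLp hζ.memLp h
    have e2 : ∫ r in Icc (0 : ℝ) R, deltaExpr ξ r * conj (h r) =
        (∫ r in Icc (0 : ℝ) R, ζ r * conj (h r)) - (a * d₁ - p * d₂) := by
      have hi₃ : Integrable (fun r => a * (D₁ r * conj (h r)) - p * (D₂ r * conj (h r)))
        (volume.restrict (Icc (0 : ℝ) R)) := (hi₁.const_mul a).sub (hi₂.const_mul p)
      rw [← integral_const_mul, ← integral_const_mul,
        ← integral_sub (hi₁.const_mul a) (hi₂.const_mul p), ← integral_sub hζi hi₃]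
      refine integral_congr_ae ?_
      filter_upwards [hIoc] with r hr
      simp only [he r hr.1, hD₁, hD₂]
      ring
    rw [e1, e2] at e0
    have hζc : Continuous ζ := hζ.1.continuous
    have hia : Integrable (fun t => ((√t * Real.log t : ℝ) : ℂ) * ζ t)
        (volume.restrict (Icc (0 : ℝ) R)) :=
      ((hc₂.mul hζc).continuousOn.integrableOn_compact isCompact_Icc)
    have hip : Integrable (fun t => (√t : ℂ) * ζ t) (volume.restrict (Icc (0 : ℝ) R)) :=
      ((hc₁.mul hζc).continuousOn.integrableOn_compact isCompact_Icc)
    have hi₃ : Integrable (fun t => ((√t * Real.log t : ℝ) : ℂ) * ζ t * d₁ - (√t : ℂ) * ζ t * d₂)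
      (volume.restrict (Icc (0 : ℝ) R)) := (hia.mul_const d₁).sub (hip.mul_const d₂)
    rw [← e0, ha, hp, ← integral_mul_const, ← integral_mul_const,
      ← integral_sub (hia.mul_const d₁) (hip.mul_const d₂), ← integral_sub hζi hi₃]
    refine integral_congr_ae (Eventually.of_forall fun r => ?_)
    simp only
    ring
  have hloc : Integrable (fun r => conj (h r) -
      (d₁ * ((√r * Real.log r : ℝ) : ℂ) - d₂ * (√r : ℂ))) (volume.restrict (Icc (0 : ℝ) R)) := by
    refine (((Lp.memLp h).star).integrable (by norm_num)).sub ?_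
    exact (((continuous_const.mul hc₂).sub (continuous_const.mul hc₁)).continuousOn.integrableOn_compact
      isCompact_Icc)
  have hae := isOpen_Ioo.ae_eq_zero_of_integral_contDiff_smul_eq_zero
    (U := Ioo (0 : ℝ) R) (hloc.locallyIntegrable.locallyIntegrableOn _) (by
      intro g hg1 hg2 hg3
      have hT : IsTestFun R fun r => (g r : ℂ) :=
        ⟨Complex.ofRealCLM.contDiff.comp hg1,
          hg2.comp_left (g := fun x : ℝ => (x : ℂ)) (by simp),
          (tsupport_comp_subset (g := fun x : ℝ => (x : ℂ)) (by simp) g).trans hg3⟩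
      simpa only [Complex.real_smul] using key _ hT)
  -- The identity obtained is for conj h, hence the conjugated coefficients.
  refine ⟨-conj d₂, conj d₁, ?_⟩
  filter_upwards [hae, hIoo] with r hr hr'
  have := congrArg conj (sub_eq_zero.1 (hr hr'))
  rw [Complex.conj_conj] at this
  rw [this]
  simp only [map_sub, map_mul, Complex.conj_ofReal]
  ring

end WeakKernel

/-! ### Construction, uniqueness and trace of the resolvent. -/

section Resolvent

variable {R : ℝ}

theorem IsWeakDelta.add {φ f φ' f' : L2Interval R} (h : IsWeakDelta R φ f)
    (h' : IsWeakDelta R φ' f') : IsWeakDelta R (φ + φ') (f + f') :=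
  (deltaMaxGraph R).add_mem (x := (φ, f)) (y := (φ', f')) h h'

theorem IsWeakDelta.sub {φ f φ' f' : L2Interval R} (h : IsWeakDelta R φ f)
    (h' : IsWeakDelta R φ' f') : IsWeakDelta R (φ - φ') (f - f') :=
  (deltaMaxGraph R).sub_mem (x := (φ, f)) (y := (φ', f')) h h'

theorem IsWeakDelta.smul {φ f : L2Interval R} (c : ℂ) (h : IsWeakDelta R φ f) :
    IsWeakDelta R (c • φ) (c • f) :=
  (deltaMaxGraph R).smul_mem (x := (φ, f)) c h

theorem exists_deltaTheta_eq (hR : 0 < R) {θ : ℝ} {u f : L2Interval R} (h : IsWeakDelta R u f)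
    (hu : u ∈ boundarySpace R hR θ) :
    ∃ x : (deltaTheta R hR θ).domain, (x : L2Interval R) = u ∧ deltaTheta R hR θ x = f := by
  have h1 : (u, f) ∈ (deltaMax R).graph := by
    rw [deltaMax_graph]
    exact h
  obtain ⟨y, hy1, hy2⟩ := (LinearPMap.mem_graph_iff _).1 h1
  simp only at hy1 hy2
  have hmem : u ∈ (deltaTheta R hR θ).domain := ⟨hu, hy1 ▸ y.2⟩
  refine ⟨⟨u, hmem⟩, rfl, ?_⟩
  rw [← hy2]
  exact LinearPMap.domRestrict_apply hy1.symm

theorem deltaTheta_spec (hR : 0 < R) {θ : ℝ} (x : (deltaTheta R hR θ).domain) :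
    IsWeakDelta R x (deltaTheta R hR θ x) ∧ (x : L2Interval R) ∈ boundarySpace R hR θ := by
  refine ⟨?_, x.2.1⟩
  have h1 := (deltaMax R).mem_graph ⟨x, x.2.2⟩
  rw [deltaMax_graph] at h1
  exact h1

theorem isWeakDelta_logModeLp_zero (hR : 0 < R) (a : ℝ) : IsWeakDelta R (logModeLp R a 0) 0 :=
  isWeakDelta_homogeneous hR (-a) 1 (fun r => by
    simp only [logMode, pow_zero, Nat.factorial_zero, harmonic_zero]
    push_cast
    ring)
    (memLp_logMode R a 0).coeFn_toLp

theorem hasBoundaryData_logModeLp_zero (R a : ℝ) :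
    HasBoundaryData R (logModeLp R a 0) (-a) 1 (logMode a 0 R) := by
  have key : ∀ r : ℝ, (logMode a 0 r : ℂ) =
      -(a : ℂ) * (√r : ℝ) + 1 * (√r * Real.log r : ℝ) + (fun _ : ℝ => (0 : ℂ)) r := by
    intro r
    simp [logMode]
    ring
  refine ⟨fun _ => 0, contDiffOn_const, isBigO_zero _ _, ?_, ?_, key R⟩
  · rw [show derivWithin (fun _ : ℝ => (0 : ℂ)) (Icc 0 R) = fun _ => 0 from
      funext fun r => by simp]
    exact isBigO_zero _ _
  · filter_upwards [(memLp_logMode R a 0).coeFn_toLp] with r hr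
    exact hr.trans (key r)

theorem isWeakDelta_neumann_logModeLp (hR : 0 < R) (a : ℝ) (z : ℂ) :
    IsWeakDelta R (neumann hR z (logModeLp R a 0)) (z • neumann hR z (logModeLp R a 0)) := by
  have h := (isWeakDelta_logModeLp_zero hR a).add
    (isWeakDelta_zeroEnergyOp hR (z • neumann hR z (logModeLp R a 0)))
  rwa [← neumann_apply, zero_add] at h

theorem hasBoundaryData_neumann_logModeLp (hR : 0 < R) (a : ℝ) (z : ℂ) :
    HasBoundaryData R (neumann hR z (logModeLp R a 0)) (-a) 1 (bdryValue hR a z) := by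
  have h := (hasBoundaryData_logModeLp_zero R a).add hR
    (hasBoundaryData_zeroEnergyOp hR (z • neumann hR z (logModeLp R a 0)))
  rw [← neumann_apply, add_zero, add_zero, map_smul] at h
  exact h

theorem neumann_logModeLp_ne_zero (hR : 0 < R) (a : ℝ) (z : ℂ) :
    neumann hR z (logModeLp R a 0) ≠ 0 := by
  intro h0
  have h := hasBoundaryData_neumann_logModeLp hR a z
  rw [h0] at h
  exact one_ne_zero (h.eq_zero hR).2.1

/-- Eigenfunctions with the boundary condition exist only at the zeros of `bdryValue`. -/
theorem eq_zero_of_isWeakDelta_smul (hR : 0 < R) {θ : ℝ} (hθ : Real.cos θ ≠ 0) {z : ℂ}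
    (hz : bdryValue hR (Real.tan θ) z ≠ 0) {x : L2Interval R} (hx : IsWeakDelta R x (z • x))
    (hb : x ∈ boundarySpace R hR θ) : x = 0 := by
  obtain ⟨c₁, c₂, hd, hc⟩ := hb
  -- Since V contributes no c₁, c₂, the homogeneous solution x - zVx has the coefficients of x. The
  -- condition at 0 makes it c₂u₀, so x = c₂N(z)u₀, and the condition at R reads c₂B(z) = 0.
  have h0 : IsWeakDelta R (x - zeroEnergyOp hR (z • x)) 0 := by
    have h := hx.sub (isWeakDelta_zeroEnergyOp hR (z • x))
    rwa [sub_self] at h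
  have hs := hd.add hR ((hasBoundaryData_zeroEnergyOp hR (z • x)).smul (-1))
  obtain ⟨a, b, hab⟩ := exists_eq_of_isWeakDelta_zero hR h0
  have hs' : HasBoundaryData R (x - zeroEnergyOp hR (z • x)) a b
      (a * (√R : ℝ) + b * (√R * Real.log R : ℝ)) := by
    refine ⟨fun _ => 0, contDiffOn_const, isBigO_zero _ _, ?_, ?_, by simp⟩
    · rw [show derivWithin (fun _ : ℝ => (0 : ℂ)) (Icc 0 R) = fun _ => 0 from
        funext fun r => by simp]
      exact isBigO_zero _ _
    · filter_upwards [hab] with r hr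
      rw [hr, add_zero]
  rw [neg_one_smul, ← sub_eq_add_neg] at hs
  obtain ⟨e1, e2, -⟩ := hs.unique hR hs'
  simp only [mul_zero, add_zero] at e1 e2
  have hcos : (Real.cos θ : ℂ) ≠ 0 := by exact_mod_cast hθ
  have hc1 : c₁ = -(Real.tan θ : ℂ) * c₂ := by
    have : (Real.tan θ : ℂ) = Real.sin θ / Real.cos θ := by
      rw [← Complex.ofReal_div, Real.tan_eq_sin_div_cos]
    rw [this]
    field_simp
    linear_combination hc
  have hu : x - zeroEnergyOp hR (z • x) = c₂ • logModeLp R (Real.tan θ) 0 := by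
    refine Lp.ext ?_
    filter_upwards [hab, (memLp_logMode R (Real.tan θ) 0).coeFn_toLp,
      Lp.coeFn_smul c₂ (logModeLp R (Real.tan θ) 0)] with r h1 h2 h3
    rw [h1, h3, Pi.smul_apply, show logModeLp R (Real.tan θ) 0 r = logMode (Real.tan θ) 0 r from h2,
      ← e1, ← e2, hc1]
    simp [logMode]
    ring
  have hx2 : x = c₂ • neumann hR z (logModeLp R (Real.tan θ) 0) := by
    rw [← map_smul, ← hu, neumann_apply']
  have hd' := (hasBoundaryData_neumann_logModeLp hR (Real.tan θ) z).smul c₂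
  rw [← hx2] at hd'
  have hc2 : c₂ = 0 := by
    have := (hd.unique hR hd').2.2
    exact (mul_eq_zero.1 this.symm).resolve_right hz
  rw [hx2, hc2, zero_smul]

/-- The resolvent of `Δ_θ`. -/
noncomputable def thetaResolvent (hR : 0 < R) (a : ℝ) (z : ℂ) :
    L2Interval R →L[ℂ] L2Interval R :=
  zeroEnergyOp hR ∘L neumann hR z +
    (bdryEval hR ∘L neumann hR z).smulRight
      (-(bdryValue hR a z)⁻¹ • neumann hR z (logModeLp R a 0))

theorem thetaResolvent_apply (hR : 0 < R) (a : ℝ) (z : ℂ) (y : L2Interval R) :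
    thetaResolvent hR a z y = zeroEnergyOp hR (neumann hR z y) +
      (bdryEval hR (neumann hR z y) * -(bdryValue hR a z)⁻¹) •
        neumann hR z (logModeLp R a 0) := by
  rw [← smul_smul]
  rfl

theorem cos_mul_neg_tan_add_sin {θ : ℝ} (hθ : Real.cos θ ≠ 0) (c : ℂ) :
    (Real.cos θ : ℂ) * (c * -(Real.tan θ : ℂ)) + (Real.sin θ : ℂ) * c = 0 := by
  have h : (Real.tan θ : ℂ) * Real.cos θ = Real.sin θ := by
    exact_mod_cast Real.tan_mul_cos hθ
  linear_combination -c * h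

theorem isWeakDelta_thetaResolvent (hR : 0 < R) (a : ℝ) (z : ℂ) (y : L2Interval R) :
    IsWeakDelta R (thetaResolvent hR a z y) (y + z • thetaResolvent hR a z y) := by
  rw [thetaResolvent_apply]
  generalize bdryEval hR (neumann hR z y) * -(bdryValue hR a z)⁻¹ = c
  have h := (isWeakDelta_zeroEnergyOp hR (neumann hR z y)).add
    ((isWeakDelta_neumann_logModeLp hR a z).smul c)
  have e : y + z • (zeroEnergyOp hR (neumann hR z y) + c • neumann hR z (logModeLp R a 0)) =
      neumann hR z y + c • z • neumann hR z (logModeLp R a 0) := by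
    have h1 := neumann_apply hR z y
    rw [map_smul] at h1
    rw [smul_add, smul_comm z c, ← add_assoc, ← h1]
  rw [e]
  exact h

theorem thetaResolvent_mem_boundarySpace (hR : 0 < R) {θ : ℝ} (hθ : Real.cos θ ≠ 0) {z : ℂ}
    (hz : bdryValue hR (Real.tan θ) z ≠ 0) (y : L2Interval R) :
    thetaResolvent hR (Real.tan θ) z y ∈ boundarySpace R hR θ := by
  rw [thetaResolvent_apply]
  have h0 : bdryEval hR (neumann hR z y) +
      bdryEval hR (neumann hR z y) * -(bdryValue hR (Real.tan θ) z)⁻¹ *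
        bdryValue hR (Real.tan θ) z = 0 := by
    field_simp
    ring
  generalize bdryEval hR (neumann hR z y) * -(bdryValue hR (Real.tan θ) z)⁻¹ = c at *
  have h := (hasBoundaryData_zeroEnergyOp hR (neumann hR z y)).add hR
    ((hasBoundaryData_neumann_logModeLp hR (Real.tan θ) z).smul c)
  rw [h0, zero_add, zero_add, mul_one] at h
  exact ⟨_, _, h, cos_mul_neg_tan_add_sin hθ c⟩

theorem isResolventAt_thetaResolvent (hR : 0 < R) {θ : ℝ} (hθ : Real.cos θ ≠ 0) {z : ℂ}
    (hz : bdryValue hR (Real.tan θ) z ≠ 0) :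
    IsResolventAt (deltaTheta R hR θ) z (thetaResolvent hR (Real.tan θ) z) := by
  have hsurj : ∀ y : L2Interval R, ∃ x : (deltaTheta R hR θ).domain,
      (x : L2Interval R) = thetaResolvent hR (Real.tan θ) z y ∧
        deltaTheta R hR θ x - z • (x : L2Interval R) = y := by
    intro y
    obtain ⟨x, hx1, hx2⟩ := exists_deltaTheta_eq hR
      (isWeakDelta_thetaResolvent hR (Real.tan θ) z y)
      (thetaResolvent_mem_boundarySpace hR hθ hz y)
    exact ⟨x, hx1, by rw [hx2, hx1, add_sub_cancel_right]⟩
  refine ⟨fun x => ?_, hsurj⟩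
  -- The left inverse property is injectivity applied to x′ - x, where x′ is the preimage already
  -- produced.
  obtain ⟨x', hx1, hx2⟩ := hsurj (deltaTheta R hR θ x - z • (x : L2Interval R))
  rw [← hx1, ← sub_eq_zero]
  obtain ⟨h1, h2⟩ := deltaTheta_spec hR x
  obtain ⟨h1', h2'⟩ := deltaTheta_spec hR x'
  refine eq_zero_of_isWeakDelta_smul hR hθ hz ?_ ((boundarySpace R hR θ).sub_mem h2' h2)
  have h3 := h1'.sub h1
  rwa [sub_eq_sub_iff_sub_eq_sub.1 hx2, ← smul_sub] at h3

theorem IsResolventAt.unique {H : Type} [NormedAddCommGroup H] [InnerProductSpace ℂ H]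
    {A : H →ₗ.[ℂ] H} {z : ℂ} {S T : H →L[ℂ] H} (hS : IsResolventAt A z S)
    (hT : IsResolventAt A z T) : S = T := by
  ext y
  obtain ⟨x, hx1, hx2⟩ := hT.2 y
  rw [← hx1, ← hS.1 x, hx2]

/-- The Volterra part has trace zero; after a Riesz representation of the functional, the trace of
the rank one part is the functional at its range vector. -/
theorem hasTrace_thetaResolvent (hR : 0 < R) (a : ℝ) (z : ℂ) :
    HasTrace (thetaResolvent hR a z)
      (-(bdryValue hR a z)⁻¹ * bdryEval hR (neumann hR z (neumann hR z (logModeLp R a 0)))) := by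
  set w := (InnerProductSpace.toDual ℂ (L2Interval R)).symm (bdryEval hR ∘L neumann hR z) with hw
  have hin : ∀ v, inner ℂ w v = bdryEval hR (neumann hR z v) := fun v => by
    rw [hw, InnerProductSpace.toDual_symm_apply]
    rfl
  have h := (hasTrace_zeroEnergyOp_comp_neumann hR z).add
    (hasTrace_rankOne w (-(bdryValue hR a z)⁻¹ • neumann hR z (logModeLp R a 0))
      ((bdryEval hR ∘L neumann hR z).smulRight
        (-(bdryValue hR a z)⁻¹ • neumann hR z (logModeLp R a 0)))
      fun v => by rw [hin]; rfl)
  rw [zero_add, hin, map_smul, map_smul, smul_eq_mul] at h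
  exact h

end Resolvent

/-! ### Continuous branches of the logarithm. -/

section Logarithm

variable {F : ℂ → ℂ} {μ : ℂ}

theorem exists_continuous_log (hF : ∀ᶠ z in 𝓝 μ, ContinuousAt F z) (h0 : F μ ≠ 0) :
    ∃ L : ℂ → ℂ, ∀ᶠ z in 𝓝 μ, ContinuousAt L z ∧ Complex.exp (L z) = F z := by
  refine ⟨fun z => Complex.log (F z / F μ) + Complex.log (F μ), ?_⟩
  have h1 : Tendsto (fun z => F z / F μ) (𝓝 μ) (𝓝 1) := by
    simpa [h0] using hF.self_of_nhds.tendsto.div_const (F μ)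
  filter_upwards [hF, h1.eventually (Complex.isOpen_slitPlane.mem_nhds Complex.one_mem_slitPlane)]
    with z hz hs
  refine ⟨((hz.div_const _).clog hs).add continuousAt_const, ?_⟩
  rw [Complex.exp_add, Complex.exp_log (Complex.slitPlane_ne_zero hs), Complex.exp_log h0,
    div_mul_cancel₀ _ h0]

/-- Continuity keeps Im(L(z) - L(μ)) inside (-π, π) near μ, so any branch is locally a constant plus
the principal logarithm of F(z)/F(μ), a quotient close to 1. -/
theorem hasDerivAt_of_exp_eq {F' : ℂ} (hF : HasDerivAt F F' μ) {L : ℂ → ℂ}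
    (hL : ∀ᶠ z in 𝓝 μ, ContinuousAt L z ∧ Complex.exp (L z) = F z) :
    HasDerivAt L (F' / F μ) μ := by
  have h0 : F μ ≠ 0 := by
    rw [← hL.self_of_nhds.2]
    exact Complex.exp_ne_zero _
  have h1 : Tendsto (fun z => (L z - L μ).im) (𝓝 μ) (𝓝 0) := by
    have h : Tendsto (fun z => L z - L μ) (𝓝 μ) (𝓝 (L μ - L μ)) :=
      hL.self_of_nhds.1.tendsto.sub tendsto_const_nhds
    rw [sub_self] at h
    simpa [Function.comp_def] using (Complex.continuous_im.tendsto 0).comp h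
  have h2 : L =ᶠ[𝓝 μ] fun z => L μ + Complex.log (F z / F μ) := by
    filter_upwards [hL, h1.eventually (Ioo_mem_nhds (neg_lt_zero.2 Real.pi_pos) Real.pi_pos)]
      with z hz him
    rw [← hz.2, ← hL.self_of_nhds.2, ← Complex.exp_sub, Complex.log_exp him.1 him.2.le]
    ring
  have h3 : F μ / F μ ∈ Complex.slitPlane := by
    rw [div_self h0]
    exact Complex.one_mem_slitPlane
  refine ((((hF.div_const (F μ)).clog h3).const_add (L μ)).congr_of_eventuallyEq h2).congr_deriv ?_
  rw [div_self h0, div_one]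

end Logarithm

/-! ### The derivative of F and the trace formula. -/

theorem hasDerivAt_charF {R : ℝ} (hR : 0 < R) (θ : ℝ) {μ : ℂ} (hμ : μ ≠ 0) :
    HasDerivAt (charF R θ) (2 / (Real.pi : ℂ) / √R * (bdryEval hR (neumann hR (μ ^ 2)
      (neumann hR (μ ^ 2) (logModeLp R (Real.tan θ) 0))) * (2 * μ))) μ := by
  have h1 : charF R θ =ᶠ[𝓝 μ] fun z =>
      2 / (Real.pi : ℂ) / √R * bdryValue hR (Real.tan θ) (z ^ 2) := by
    filter_upwards [isOpen_ne.mem_nhds hμ] with z hz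
    exact charF_eq hR θ hz
  have h2 : HasDerivAt (fun z : ℂ => z ^ 2) (2 * μ) μ := by simpa using hasDerivAt_pow 2 μ
  have h3 := (hasDerivAt_bdryValue hR (Real.tan θ) (μ ^ 2)).comp μ h2
  exact (h3.const_mul (2 / (Real.pi : ℂ) / √R)).congr_of_eventuallyEq h1

theorem theoremA1 (R : ℝ) (hR : 0 < R) (θ : ℝ) (hθ₀ : 0 ≤ θ) (hθ₁ : θ < Real.pi)
    (hθ : θ ≠ Real.pi / 2) (μ : ℂ) (hμ : μ ≠ 0) :
    (μ ^ 2 ∈ unboundedResolventSet (deltaTheta R hR θ) ↔ charF R θ μ ≠ 0) ∧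
    ∀ S : L2Interval R →L[ℂ] L2Interval R, IsResolventAt (deltaTheta R hR θ) (μ ^ 2) S →
      DifferentiableAt ℂ (charF R θ) μ ∧
      HasTrace S (-(1 / (2 * μ)) * (1 / charF R θ μ) * deriv (charF R θ) μ) ∧
      (∃ logF : ℂ → ℂ, ∀ᶠ z in 𝓝 μ,
        ContinuousAt logF z ∧ Complex.exp (logF z) = charF R θ z) ∧
      ∀ logF : ℂ → ℂ,
        (∀ᶠ z in 𝓝 μ, ContinuousAt logF z ∧ Complex.exp (logF z) = charF R θ z) →
        DifferentiableAt ℂ logF μ ∧ HasTrace S (-(1 / (2 * μ)) * deriv logF μ) := by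
  -- On [0, π] the cosine is injective, so it vanishes only at the excluded angle; this lets the
  -- boundary condition be solved as c₁ = -c₂ tan θ.
  have hcos : Real.cos θ ≠ 0 := by
    intro h
    refine hθ (Real.injOn_cos ⟨hθ₀, hθ₁.le⟩ ⟨by positivity, ?_⟩ (h.trans Real.cos_pi_div_two.symm))
    linarith [Real.pi_pos]
  have h1 : (√R : ℂ) ≠ 0 := by exact_mod_cast (Real.sqrt_pos.2 hR).ne'
  have hk : 2 / (Real.pi : ℂ) / √R ≠ 0 := by
    have h2 : (Real.pi : ℂ) ≠ 0 := by exact_mod_cast Real.pi_ne_zero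
    exact div_ne_zero (div_ne_zero two_ne_zero h2) h1
  have hiff : charF R θ μ ≠ 0 ↔ bdryValue hR (Real.tan θ) (μ ^ 2) ≠ 0 := by
    rw [charF_eq hR θ hμ, mul_ne_zero_iff]
    exact and_iff_right hk
  -- At a zero of F, the function N(μ²)u₀ is a nonzero eigenfunction in the domain, and a left
  -- inverse would send 0 to it.
  have hmem : ∀ S, IsResolventAt (deltaTheta R hR θ) (μ ^ 2) S → charF R θ μ ≠ 0 := by
    intro S hS
    rw [hiff]
    intro h0
    have hb := hasBoundaryData_neumann_logModeLp hR (Real.tan θ) (μ ^ 2)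
    rw [h0] at hb
    obtain ⟨x, hx1, hx2⟩ := exists_deltaTheta_eq hR (θ := θ)
      (isWeakDelta_neumann_logModeLp hR (Real.tan θ) (μ ^ 2)) ⟨_, _, hb,
        by simpa using cos_mul_neg_tan_add_sin hcos 1⟩
    have h1 := hS.1 x
    rw [hx2, hx1, sub_self, map_zero] at h1
    exact neumann_logModeLp_ne_zero hR _ _ h1.symm
  refine ⟨⟨fun ⟨S, hS⟩ => hmem S hS, fun h =>
    ⟨_, isResolventAt_thetaResolvent hR hcos (hiff.1 h)⟩⟩, fun S hS => ?_⟩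
  have hF := hmem S hS
  have hm := hiff.1 hF
  have hd := hasDerivAt_charF hR θ hμ
  have htr : HasTrace S (-(1 / (2 * μ)) * (1 / charF R θ μ) * deriv (charF R θ) μ) := by
    -- Any resolvent is the explicit one. The constant (2/π)R^{-1/2} cancels in F′/F, and the chain
    -- rule factor 2μ cancels 1/(2μ).
    rw [hS.unique (isResolventAt_thetaResolvent hR hcos hm), hd.deriv, charF_eq hR θ hμ]
    convert hasTrace_thetaResolvent hR (Real.tan θ) (μ ^ 2) using 1
    field_simp
  refine ⟨hd.differentiableAt, htr, exists_continuous_log ?_ hF, fun logF hlog => ?_⟩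
  · filter_upwards [isOpen_ne.mem_nhds hμ] with z hz
    exact (hasDerivAt_charF hR θ hz).continuousAt
  · have hl := hasDerivAt_of_exp_eq hd hlog
    refine ⟨hl.differentiableAt, ?_⟩
    rw [hl.deriv, ← hd.deriv]
    convert htr using 1
    ring
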